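/- **Setting.** An MDP $\mathcal M=(S,\mathit{Act},P,\mathsf{AP},L)$ has a non-empty finite state set $S$, a finite action set $\mathit{Act}$, transition probabilities $P(s,\alpha,s')\in[0,1]$ such that $\sum_{s'}P(s,\alpha,s')$ is $1$ (then $\alpha$ is enabled, $\alpha\in\mathit{Act}(s)$) or $0$, with $\mathit{Act}(s)\neq\emptyset$ for all $s$, and a labelling $L:S\to 2^{\mathsf{AP}}$. A non-probabilistic memoryless scheduler is a map $\sigma:S\to\mathit{Act}$ with $\sigma(s)\in\mathit{Act}(s)$. The $n$-ary self-composition $\mathcal M^\sigma_n$ is the Markov chain on $S^n$ with transition probabilities $\prod_i P(s_i,\sigma(s_i),s_i')$ in which $a_{i}$ holds in $\vec s$ iff $a\in L(s_i)$. Let $\mathrm{supp}_{\vec s}(\vec\alpha)=\prod_i\{s':P(s_i,\alpha_i,s')>0\}$. Quantifier-free formulas, probability expressions and path formulas are given by $\varphi::=\mathtt{true}\mid a_{\hat s_i}\mid\varphi\wedge\varphi\mid\neg\varphi\mid e<e$, $\;e::=\mathbb P(\psi)\mid c\mid e+e\mid e-e\mid e*e$ $(c\in\mathbb R)$, $\;\psi::=\mathsf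 X\varphi\mid\varphi\,\mathcal U\,\varphi\mid\varphi\,\mathcal U^{[k_1,k_2]}\varphi$ $(k_1\le k_2)$, $1\le i\le n$, interpreted as usual in the states and on the infinite paths of $\mathcal M^\sigma_n$; $\mathbb P(\psi)$ is the probability of the paths from the current state that satisfy $\psi$. The input formula is $\Phi=Q\hat\sigma.\,Q_1\hat s_1(\hat\sigma)\ldots Q_n\hat s_n(\hat\sigma).\,\varphi$ with $Q,Q_i\in\{\exists,\forall\}$; $\mathcal M\models\Phi$ means that for some (resp. all) non-probabilistic memoryless $\sigma$ the quantified states $Q_1s_1\in S\ldots Q_ns_n\in S$ are such that $(s_1,\dots,s_n)$ satisfies $\varphi$ in $\mathcal M^\sigma_n$. **Encoding.** The SMT variables are $\sigma_s\in\mathit{Act}$; propositions $h_{\vec s,\varphi}$; $p_{\vec s,e}$, ranging over $[0,1]$ if $e=\mathbb P(\psi)$ and over $\mathbb R$ otherwise; $t_{\vec s,\varphi}\in\{0,1\}$; and $d_{\vec s,\varphi}\in D$, where $D$ is a linear order with at least $|S|^n$ elements. $\mathrm{Sem}(\cdot)$ is the conjunction of $\mathrm{Sem}$ of the immediate sub-formulas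 and sub-expressions with the following constraints for all $\vec s\in S^n$ and all $\vec\alpha\in\prod_i\mathit{Act}(s_i)$, where $\mathrm{ch}_{\vec\alpha}:=\bigwedge_i\sigma_{s_i}=\alpha_i$ and $\Sigma_{\vec\alpha}x:=\sum_{\vec s'\in\mathrm{supp}_{\vec s}(\vec\alpha)}\prod_iP(s_i,\alpha_i,s_i')\cdot x_{\vec s'}$: - $h_{\vec s,\mathtt{true}}$; $\;h_{\vec s,a_{\hat s_i}}$ if $a\in L(s_i)$ and $\neg h_{\vec s,a_{\hat s_i}}$ otherwise; $\;h_{\vec s,\varphi_1\wedge\varphi_2}\leftrightarrow(h_{\vec s,\varphi_1}\wedge h_{\vec s,\varphi_2})$; $\;h_{\vec s,\neg\varphi}\oplus h_{\vec s,\varphi}$; $\;h_{\vec s,e_1<e_2}\leftrightarrow p_{\vec s,e_1}<p_{\vec s,e_2}$; $\;p_{\vec s,c}=c$; $\;p_{\vec s,e_1\circ e_2}=p_{\vec s,e_1}\circ p_{\vec s,e_2}$ for $\circ\in\{+,-,*\}$. - $e=\mathbb P(\mathsf X\varphi)$: $(t_{\vec s,\varphi}=1\wedge h_{\vec s,\varphi})\vee(t_{\vec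 s,\varphi}=0\wedge\neg h_{\vec s,\varphi})$, and $\mathrm{ch}_{\vec\alpha}\to p_{\vec s,e}=\Sigma_{\vec\alpha}t_{\cdot,\varphi}$. - $e=\mathbb P(\varphi_1\,\mathcal U\,\varphi_2)$: $h_{\vec s,\varphi_2}\to p_{\vec s,e}=1$; $(\neg h_{\vec s,\varphi_1}\wedge\neg h_{\vec s,\varphi_2})\to p_{\vec s,e}=0$; and $(h_{\vec s,\varphi_1}\wedge\neg h_{\vec s,\varphi_2}\wedge\mathrm{ch}_{\vec\alpha})\to\big[p_{\vec s,e}=\Sigma_{\vec\alpha}p_{\cdot,e}\wedge\big(p_{\vec s,e}>0\to\bigvee_{\vec s'\in\mathrm{supp}_{\vec s}(\vec\alpha)}(h_{\vec s',\varphi_2}\vee d_{\vec s,\varphi_2}>d_{\vec s',\varphi_2})\big)\big]$. - $e=\mathbb P(\varphi_1\,\mathcal U^{[k_1,k_2]}\varphi_2)$: if $k_2=0$: $h_{\vec s,\varphi_2}\to p_{\vec s,e}=1$ and $\neg h_{\vec s,\varphi_2}\to p_{\vec s,e}=0$. If $0=k_1<k_2$, with $e'=\mathbb P(\varphi_1\,\mathcal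 U^{[0,k_2-1]}\varphi_2)$: the constraints for $e'$; $h_{\vec s,\varphi_2}\to p_{\vec s,e}=1$; $(\neg h_{\vec s,\varphi_1}\wedge\neg h_{\vec s,\varphi_2})\to p_{\vec s,e}=0$; $(h_{\vec s,\varphi_1}\wedge\neg h_{\vec s,\varphi_2}\wedge\mathrm{ch}_{\vec\alpha})\to p_{\vec s,e}=\Sigma_{\vec\alpha}p_{\cdot,e'}$. If $k_1>0$, with $e'=\mathbb P(\varphi_1\,\mathcal U^{[k_1-1,k_2-1]}\varphi_2)$: the constraints for $e'$; $\neg h_{\vec s,\varphi_1}\to p_{\vec s,e}=0$; $(h_{\vec s,\varphi_1}\wedge\mathrm{ch}_{\vec\alpha})\to p_{\vec s,e}=\Sigma_{\vec\alpha}p_{\cdot,e'}$. $\mathrm{Truth}(Q_1\ldots Q_n,\varphi)$ is $B_1\ldots B_n\,h_{(s_1,\dots,s_n),\varphi}$ with $B_i=\bigwedge_{s_i\in S}$ if $Q_i=\forall$ and $B_i=\bigvee_{s_i\in S}$ if $Q_i=\exists$. Let $\mathrm{Sched}=\bigwedge_{s\in S}\bigvee_{\alpha\in\mathit{Act}(s)}\sigma_s=\alpha$.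 The algorithm forms $E=\mathrm{Sched}\wedge\mathrm{Sem}(\varphi)\wedge\mathrm{Truth}(Q_1\ldots Q_n,\varphi)$ if $Q=\exists$ and returns TRUE iff $E$ is satisfiable; if $Q=\forall$ it forms $E=\mathrm{Sched}\wedge\mathrm{Sem}(\neg\varphi)\wedge\mathrm{Truth}(\overline Q_1\ldots\overline Q_n,\neg\varphi)$ with the dual quantifiers $\overline Q_i$ and returns TRUE iff $E$ is unsatisfiable. **Theorem.** For every MDP $\mathcal M$ and every input formula $\Phi$: 1. the algorithm returns TRUE iff $\mathcal M\models\Phi$; that is, if $Q=\exists$ then $E$ is satisfiable iff $\mathcal M\models\Phi$, and if $Q=\forall$ then $E$ is unsatisfiable iff $\mathcal M\models\Phi$; 2. in every solution of $E$ the values of the $\sigma_s$ form a scheduler $\sigma$, and for every expression $e=\mathbb P(\varphi_1\,\mathcal U\,\varphi_2)$ that occurs in $\varphi$, the function $\vec s\mapsto p_{\vec s,e}$ is the least function $x:S^n\to[0,1]$ such that $x_{\vec s}=1$ if $\vec s\models\varphi_2$, $x_{\vec s}=0$ if $\vec s\not\models\varphi_1$ and $\vec s\not\models\varphi_2$, and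 $x_{\vec s}=\sum_{\vec s'}\prod_iP(s_i,\sigma(s_i),s'_i)\,x_{\vec s'}$ otherwise (satisfaction in $\mathcal M^\sigma_n$), and $p_{\vec s,e}$ is the probability of $\varphi_1\,\mathcal U\,\varphi_2$ from $\vec s$ in $\mathcal M^\sigma_n$. -/

import Mathlib

namespace HyperPCTL

open MeasureTheory ProbabilityTheory
open scoped BigOperators

/-! ### Markov models -/

/-- A Markov decision process with (finite) state set `S`, (finite) action set `Act` and atomic
propositions `AP`. For every state and action the outgoing probabilities sum to `1` (the action is
enabled) or to `0` (it is not), and every state has an enabled action. -/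
structure MDP (S Act AP : Type*) [Fintype S] where
  P : S → Act → S → ℝ
  P_mem : ∀ s α s', P s α s' ∈ Set.Icc (0 : ℝ) 1
  sum_P : ∀ s α, ∑ s', P s α s' = 1 ∨ ∑ s', P s α s' = 0
  exists_enabled : ∀ s, ∃ α, ∑ s', P s α s' = 1
  L : S → Set AP

/-- A labelled discrete-time Markov chain with (finite) state set `T`. -/
structure DTMC (T AP : Type*) [Fintype T] where
  P : T → T → ℝ
  nonneg : ∀ t t', 0 ≤ P t t'
  sum_P : ∀ t, ∑ t', P t t' = 1
  L : T → Set AP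

section Models

variable {S Act AP T : Type*} [Fintype S] [Fintype T]

open Classical in
/-- `Act(s)`: the actions enabled in `s`. -/
noncomputable def MDP.enabled [Fintype Act] (M : MDP S Act AP) (s : S) : Finset Act :=
  Finset.univ.filter fun α => ∑ s', M.P s α s' = 1

open Classical in
/-- `supp(α)`: the support of the distribution that the action `α` has in the state `s`. -/
noncomputable def MDP.supp (M : MDP S Act AP) (s : S) (α : Act) : Finset S :=
  Finset.univ.filter fun s' => 0 < M.P s α s'

/-- Non-probabilistic memoryless schedulers: they choose an enabled action in every state. -/
def MDP.Scheduler [Fintype Act] (M : MDP S Act AP) : Type _ :=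
  {σ : S → Act // ∀ s, σ s ∈ M.enabled s}

/-- The Markov chain that a non-probabilistic memoryless scheduler induces. -/
noncomputable def MDP.induced [Fintype Act] (M : MDP S Act AP) (σ : M.Scheduler) : DTMC S AP where
  P s s' := M.P s (σ.1 s) s'
  nonneg s s' := (M.P_mem s (σ.1 s) s').1
  sum_P s := by
    have h := σ.2 s
    simpa [MDP.enabled] using h
  L := M.L

/-- The `n`-ary composition of Markov chains: the components move independently, and the
proposition `(a, i)` (written `a_i`) holds in `(s_1, …, s_n)` iff `a` holds in `s_i`. -/
noncomputable def DTMC.compose {n : ℕ} (C : Fin n → DTMC S AP) :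
    DTMC (Fin n → S) (AP × Fin n) where
  P s s' := ∏ i, (C i).P (s i) (s' i)
  nonneg s s' := Finset.prod_nonneg fun i _ => (C i).nonneg _ _
  sum_P s := by
    classical
    rw [← Fintype.prod_sum (fun i t => (C i).P (s i) t)]
    exact Finset.prod_eq_one fun i _ => (C i).sum_P (s i)
  L s := {x | x.1 ∈ (C x.2).L (s x.2)}

/-- The `n`-ary self-composition of `M` under the scheduler `σ`. -/
noncomputable def MDP.selfComp [Fintype Act] (M : MDP S Act AP) (σ : M.Scheduler) (n : ℕ) :
    DTMC (Fin n → S) (AP × Fin n) :=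
  DTMC.compose fun _ => M.induced σ

/-- The distribution of the successor of `t`. -/
noncomputable def DTMC.succPMF (C : DTMC T AP) (t : T) : PMF T :=
  PMF.ofFintype (fun t' => ENNReal.ofReal (C.P t t')) (by
    rw [← ENNReal.ofReal_sum_of_nonneg fun t' _ => C.nonneg t t', C.sum_P, ENNReal.ofReal_one])

/-- The one-step transition kernel. -/
noncomputable def DTMC.stepKernel [MeasurableSpace T] [DiscreteMeasurableSpace T]
    (C : DTMC T AP) : Kernel T T :=
  Kernel.ofFunOfCountable fun t => (C.succPMF t).toMeasure

instance DTMC.isMarkovKernel_stepKernel [MeasurableSpace T] [DiscreteMeasurableSpace T]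
    (C : DTMC T AP) : IsMarkovKernel C.stepKernel :=
  ⟨fun t => inferInstanceAs (IsProbabilityMeasure (C.succPMF t).toMeasure)⟩

/-- The kernel that continues a finite path `t_0 … t_m` by a successor of `t_m`. -/
noncomputable def DTMC.histKernel [MeasurableSpace T] [DiscreteMeasurableSpace T]
    (C : DTMC T AP) (m : ℕ) : Kernel ((_ : Finset.Iic m) → T) T :=
  C.stepKernel.comap (fun h => h ⟨m, Finset.mem_Iic.2 le_rfl⟩) (measurable_pi_apply _)

instance DTMC.isMarkovKernel_histKernel [MeasurableSpace T] [DiscreteMeasurableSpace T]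
    (C : DTMC T AP) (m : ℕ) : IsMarkovKernel (C.histKernel m) := by
  unfold DTMC.histKernel; infer_instance

/-- The probability measure on the infinite paths that start in `t` (Ionescu-Tulcea). -/
noncomputable def DTMC.pathMeasure [MeasurableSpace T] [DiscreteMeasurableSpace T]
    (C : DTMC T AP) (t : T) : Measure (ℕ → T) :=
  Kernel.traj (X := fun _ => T) C.histKernel 0 (fun _ => t)

/-- The probability of a set of infinite paths that start in `t`; the finite state set carries the
discrete σ-algebra and the set of paths the product σ-algebra. -/
noncomputable def DTMC.prob (C : DTMC T AP) (t : T) (A : Set (ℕ → T)) : ℝ :=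
  letI : MeasurableSpace T := ⊤
  haveI : DiscreteMeasurableSpace T := ⟨fun _ => trivial⟩
  (C.pathMeasure t).real A

end Models

/-! ### HyperPCTL with a single scheduler quantifier -/

universe u

mutual

/-- Quantifier-free HyperPCTL formulas over the state variables `ŝ_1, …, ŝ_n`. -/
inductive Form (AP : Type u) (n : ℕ)
  | tru : Form AP n
  | atom (a : AP) (i : Fin n) : Form AP n
  | and (φ₁ φ₂ : Form AP n) : Form AP n
  | neg (φ : Form AP n) : Form AP n
  | lt (e₁ e₂ : Expr AP n) : Form AP n

/-- Probability expressions. -/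
inductive Expr (AP : Type u) (n : ℕ)
  | prob (ψ : PathForm AP n) : Expr AP n
  | const (c : ℝ) : Expr AP n
  | add (e₁ e₂ : Expr AP n) : Expr AP n
  | sub (e₁ e₂ : Expr AP n) : Expr AP n
  | mul (e₁ e₂ : Expr AP n) : Expr AP n

/-- Path formulas: next, unbounded until, and until with the time bounds `[k₁, k₂]`. -/
inductive PathForm (AP : Type u) (n : ℕ)
  | next (φ : Form AP n) : PathForm AP n
  | unt (φ₁ φ₂ : Form AP n) : PathForm AP n
  | bunt (φ₁ φ₂ : Form AP n) (k₁ k₂ : ℕ) (hk : k₁ ≤ k₂) : PathForm AP n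

end

/-- Quantifiers. -/
inductive Quant
  | ex
  | all

/-- The dual quantifier. -/
def Quant.dual : Quant → Quant
  | .ex => .all
  | .all => .ex

/-- The formula `Q σ̂. Q_1 ŝ_1(σ̂). … Q_n ŝ_n(σ̂). φ`. -/
structure Formula (AP : Type*) (n : ℕ) where
  schedQ : Quant
  stateQ : Fin n → Quant
  body : Form AP n

section Semantics

variable {S Act AP T : Type*} {n : ℕ} [Fintype T]

mutual

/-- Satisfaction of a quantifier-free formula in a state of (a chain that plays the role of) the
`n`-ary self-composition. -/
noncomputable def Form.Sat (C : DTMC T (AP × Fin n)) : Form AP n → T → Prop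
  | .tru, _ => True
  | .atom a i, t => (a, i) ∈ C.L t
  | .and φ₁ φ₂, t => φ₁.Sat C t ∧ φ₂.Sat C t
  | .neg φ, t => ¬ φ.Sat C t
  | .lt e₁ e₂, t => e₁.val C t < e₂.val C t

/-- The value of a probability expression in a state. -/
noncomputable def Expr.val (C : DTMC T (AP × Fin n)) : Expr AP n → T → ℝ
  | .prob ψ, t => C.prob t {π | ψ.Sat C π}
  | .const c, _ => c
  | .add e₁ e₂, t => e₁.val C t + e₂.val C t
  | .sub e₁ e₂, t => e₁.val C t - e₂.val C t
  | .mul e₁ e₂, t => e₁.val C t * e₂.val C t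

/-- Satisfaction of a path formula on an infinite path. -/
noncomputable def PathForm.Sat (C : DTMC T (AP × Fin n)) : PathForm AP n → (ℕ → T) → Prop
  | .next φ, π => φ.Sat C (π 1)
  | .unt φ₁ φ₂, π => ∃ j, φ₂.Sat C (π j) ∧ ∀ i < j, φ₁.Sat C (π i)
  | .bunt φ₁ φ₂ k₁ k₂ _, π =>
      ∃ j, k₁ ≤ j ∧ j ≤ k₂ ∧ φ₂.Sat C (π j) ∧ ∀ i < j, φ₁.Sat C (π i)

end

/-- Meaning of the state quantifier prefix `Q_1 s_1. … Q_n s_n.` in front of the predicate `p`. -/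
def StatePrefix {S : Type*} : {n : ℕ} → (Fin n → Quant) → ((Fin n → S) → Prop) → Prop
  | 0, _, p => p Fin.elim0
  | _ + 1, Q, p =>
      match Q 0 with
      | .ex => ∃ s : S, StatePrefix (fun i => Q i.succ) fun v => p (Fin.cons s v)
      | .all => ∀ s : S, StatePrefix (fun i => Q i.succ) fun v => p (Fin.cons s v)

/-- `M ⊨ Φ`, where the scheduler quantifier ranges over non-probabilistic memoryless schedulers. -/
def MDP.Satisfies [Fintype S] [Fintype Act] (M : MDP S Act AP) (Φ : Formula AP n) : Prop :=
  match Φ.schedQ with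
  | .ex => ∃ σ : M.Scheduler, StatePrefix Φ.stateQ fun s => Φ.body.Sat (M.selfComp σ n) s
  | .all => ∀ σ : M.Scheduler, StatePrefix Φ.stateQ fun s => Φ.body.Sat (M.selfComp σ n) s

end Semantics

/-! ### The SMT language -/

/-- Real-valued SMT terms over the variables `pr_{s,e}` and `toInt_{s,φ}`. -/
inductive Term (S AP : Type*) (n : ℕ)
  | const (c : ℝ) : Term S AP n
  | pr (s : Fin n → S) (e : Expr AP n) : Term S AP n
  | toInt (s : Fin n → S) (φ : Form AP n) : Term S AP n
  | add (t₁ t₂ : Term S AP n) : Term S AP n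
  | sub (t₁ t₂ : Term S AP n) : Term S AP n
  | mul (t₁ t₂ : Term S AP n) : Term S AP n

/-- Quantifier-free SMT formulas over the scheduler variables `σ_s`, the propositions
`holds_{s,φ}`, the numeric variables and the distance variables `d_{s,φ}`. -/
inductive SMT (S Act AP : Type*) (n : ℕ)
  | tru : SMT S Act AP n
  | fls : SMT S Act AP n
  /-- `σ_s = α` -/
  | schedEq (s : S) (α : Act) : SMT S Act AP n
  /-- `holds_{s,φ}` -/
  | holds (s : Fin n → S) (φ : Form AP n) : SMT S Act AP n
  /-- `d_{s,φ} > d_{s',φ}` -/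
  | distGt (s s' : Fin n → S) (φ : Form AP n) : SMT S Act AP n
  | eq (t₁ t₂ : Term S AP n) : SMT S Act AP n
  | lt (t₁ t₂ : Term S AP n) : SMT S Act AP n
  | ge (t₁ t₂ : Term S AP n) : SMT S Act AP n
  | not (F : SMT S Act AP n) : SMT S Act AP n
  | and (F G : SMT S Act AP n) : SMT S Act AP n
  | or (F G : SMT S Act AP n) : SMT S Act AP n
  | xor (F G : SMT S Act AP n) : SMT S Act AP n
  | imp (F G : SMT S Act AP n) : SMT S Act AP n

section SMTSemantics

variable {S Act AP : Type*} {n : ℕ}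

/-- Assignments of values to the SMT variables. The variables `toInt` range over `{0,1}`, the
variables for the value of an expression `ℙ(ψ)` over `[0,1]`, the variables for the values of other
(arithmetic) expressions over `ℝ`, and the distance variables over the ordered set `D`. -/
structure Assignment (S Act AP : Type*) (n : ℕ) (D : Type*) where
  sched : S → Act
  holds : (Fin n → S) → Form AP n → Prop
  pr : (Fin n → S) → Expr AP n → ℝ
  pr_mem : ∀ s ψ, pr s (.prob ψ) ∈ Set.Icc (0 : ℝ) 1
  toInt : (Fin n → S) → Form AP n → ℝ
  toInt_mem : ∀ s φ, toInt s φ = 0 ∨ toInt s φ = 1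
  dist : (Fin n → S) → Form AP n → D

/-- Value of a term under an assignment. -/
def Term.eval {D : Type*} (ν : Assignment S Act AP n D) : Term S AP n → ℝ
  | .const c => c
  | .pr s e => ν.pr s e
  | .toInt s φ => ν.toInt s φ
  | .add t₁ t₂ => t₁.eval ν + t₂.eval ν
  | .sub t₁ t₂ => t₁.eval ν - t₂.eval ν
  | .mul t₁ t₂ => t₁.eval ν * t₂.eval ν

/-- Truth of an SMT formula under an assignment. -/
def SMT.Holds {D : Type*} [LinearOrder D] (ν : Assignment S Act AP n D) : SMT S Act AP n → Prop
  | .tru => True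
  | .fls => False
  | .schedEq s α => ν.sched s = α
  | .holds s φ => ν.holds s φ
  | .distGt s s' φ => ν.dist s φ > ν.dist s' φ
  | .eq t₁ t₂ => t₁.eval ν = t₂.eval ν
  | .lt t₁ t₂ => t₁.eval ν < t₂.eval ν
  | .ge t₁ t₂ => t₁.eval ν ≥ t₂.eval ν
  | .not F => ¬ F.Holds ν
  | .and F G => F.Holds ν ∧ G.Holds ν
  | .or F G => F.Holds ν ∨ G.Holds ν
  | .xor F G => Xor (F.Holds ν) (G.Holds ν)
  | .imp F G => F.Holds ν → G.Holds ν

/-- Satisfiability, with distance variables that range over `D`. -/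
def SMT.Satisfiable (D : Type*) [LinearOrder D] (F : SMT S Act AP n) : Prop :=
  ∃ ν : Assignment S Act AP n D, F.Holds ν

/-- Finite conjunction. -/
noncomputable def SMT.conj {ι : Type*} (I : Finset ι) (F : ι → SMT S Act AP n) : SMT S Act AP n :=
  (I.toList.map F).foldr .and .tru

/-- Finite disjunction. -/
noncomputable def SMT.disj {ι : Type*} (I : Finset ι) (F : ι → SMT S Act AP n) : SMT S Act AP n :=
  (I.toList.map F).foldr .or .fls

/-- Finite sum of terms. -/
noncomputable def Term.sum {ι : Type*} (I : Finset ι) (t : ι → Term S AP n) : Term S AP n :=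
  (I.toList.map t).foldr .add (.const 0)

end SMTSemantics

/-! ### The encoding -/

section Encoding

variable {S Act AP : Type*} [Fintype S] [Fintype Act] {n : ℕ}

/-- All composed states `s ∈ S^n`. -/
noncomputable def states (S : Type*) [Fintype S] (n : ℕ) : Finset (Fin n → S) := Finset.univ

open Classical in
/-- All composed states with the property `p`. -/
noncomputable def statesWith {S : Type*} [Fintype S] {n : ℕ} (p : (Fin n → S) → Prop) :
    Finset (Fin n → S) := Finset.univ.filter p

/-- `Act(s_1) × … × Act(s_n)`. -/
noncomputable def MDP.enabledVec (M : MDP S Act AP) (s : Fin n → S) : Finset (Fin n → Act) :=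
  Fintype.piFinset fun i => M.enabled (s i)

/-- `supp(α_1) × … × supp(α_n)`. -/
noncomputable def MDP.suppVec (M : MDP S Act AP) (s : Fin n → S) (α : Fin n → Act) :
    Finset (Fin n → S) :=
  Fintype.piFinset fun i => M.supp (s i) (α i)

/-- `⋀_i σ_{s_i} = α_i`. -/
noncomputable def chosen (s : Fin n → S) (α : Fin n → Act) : SMT S Act AP n :=
  SMT.conj Finset.univ fun i => .schedEq (s i) (α i)

/-- `∑_{s' ∈ supp(α_1) × … × supp(α_n)} (∏_i P(s_i, α_i, s'_i)) · x_{s'}`. -/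
noncomputable def succSum (M : MDP S Act AP) (s : Fin n → S) (α : Fin n → Act)
    (x : (Fin n → S) → Term S AP n) : Term S AP n :=
  Term.sum (M.suppVec s α) fun s' => .mul (.const (∏ i, M.P (s i) (α i) (s' i))) (x s')

/-- Unbounded until; `base` is the encoding of the two operands. -/
noncomputable def semanticsUnboundedUntil (M : MDP S Act AP) (base : SMT S Act AP n)
    (φ₁ φ₂ : Form AP n) : SMT S Act AP n :=
  let e : Expr AP n := .prob (.unt φ₁ φ₂)
  .and base <|
    .conj (states S n) fun s =>
      .and
        (.and (.imp (.holds s φ₂) (.eq (.pr s e) (.const 1)))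
          (.imp (.and (.not (.holds s φ₁)) (.not (.holds s φ₂))) (.eq (.pr s e) (.const 0))))
        (.conj (M.enabledVec s) fun α =>
          .imp (.and (.holds s φ₁) (.and (.not (.holds s φ₂)) (chosen s α)))
            (.and (.eq (.pr s e) (succSum M s α fun s' => .pr s' e))
              (.imp (.lt (.const 0) (.pr s e))
                (.disj (M.suppVec s α) fun s' => .or (.holds s' φ₂) (.distGt s s' φ₂)))))

/-- Bounded until; `base` is the encoding of the two operands. -/
noncomputable def semanticsBoundedUntil (M : MDP S Act AP) (base : SMT S Act AP n)
    (φ₁ φ₂ : Form AP n) : (k₁ k₂ : ℕ) → k₁ ≤ k₂ → SMT S Act AP n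
  | k₁, 0, hk =>
      let e : Expr AP n := .prob (.bunt φ₁ φ₂ k₁ 0 hk)
      .and base <|
        .conj (states S n) fun s =>
          .and (.imp (.holds s φ₂) (.eq (.pr s e) (.const 1)))
            (.imp (.not (.holds s φ₂)) (.eq (.pr s e) (.const 0)))
  | 0, k₂ + 1, hk =>
      let e : Expr AP n := .prob (.bunt φ₁ φ₂ 0 (k₂ + 1) hk)
      let e' : Expr AP n := .prob (.bunt φ₁ φ₂ 0 k₂ (Nat.zero_le k₂))
      .and (semanticsBoundedUntil M base φ₁ φ₂ 0 k₂ (Nat.zero_le k₂)) <|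
        .conj (states S n) fun s =>
          .and
            (.and (.imp (.holds s φ₂) (.eq (.pr s e) (.const 1)))
              (.imp (.and (.not (.holds s φ₁)) (.not (.holds s φ₂))) (.eq (.pr s e) (.const 0))))
            (.conj (M.enabledVec s) fun α =>
              .imp (.and (.holds s φ₁) (.and (.not (.holds s φ₂)) (chosen s α)))
                (.eq (.pr s e) (succSum M s α fun s' => .pr s' e')))
  | k₁ + 1, k₂ + 1, hk =>
      let e : Expr AP n := .prob (.bunt φ₁ φ₂ (k₁ + 1) (k₂ + 1) hk)
      let e' : Expr AP n := .prob (.bunt φ₁ φ₂ k₁ k₂ (Nat.le_of_succ_le_succ hk))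
      .and (semanticsBoundedUntil M base φ₁ φ₂ k₁ k₂ (Nat.le_of_succ_le_succ hk)) <|
        .conj (states S n) fun s =>
          .and (.imp (.not (.holds s φ₁)) (.eq (.pr s e) (.const 0)))
            (.conj (M.enabledVec s) fun α =>
              .imp (.and (.holds s φ₁) (chosen s α))
                (.eq (.pr s e) (succSum M s α fun s' => .pr s' e')))

mutual

/-- The encoding of the meaning of a quantifier-free formula. -/
noncomputable def Form.semantics (M : MDP S Act AP) : Form AP n → SMT S Act AP n
  | .tru => .conj (states S n) fun s => .holds s .tru
  | .atom a i =>
      .and (.conj (statesWith fun s : Fin n → S => a ∈ M.L (s i)) fun s => .holds s (.atom a i))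
        (.conj (statesWith fun s : Fin n → S => a ∉ M.L (s i)) fun s => .not (.holds s (.atom a i)))
  | .and φ₁ φ₂ =>
      .and (.and (φ₁.semantics M) (φ₂.semantics M)) <|
        .conj (states S n) fun s =>
          .or (.and (.holds s (.and φ₁ φ₂)) (.and (.holds s φ₁) (.holds s φ₂)))
            (.and (.not (.holds s (.and φ₁ φ₂))) (.or (.not (.holds s φ₁)) (.not (.holds s φ₂))))
  | .neg φ =>
      .and (φ.semantics M) <| .conj (states S n) fun s => .xor (.holds s (.neg φ)) (.holds s φ)
  | .lt e₁ e₂ =>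
      .and (.and (e₁.semantics M) (e₂.semantics M)) <|
        .conj (states S n) fun s =>
          .or (.and (.holds s (.lt e₁ e₂)) (.lt (.pr s e₁) (.pr s e₂)))
            (.and (.not (.holds s (.lt e₁ e₂))) (.ge (.pr s e₁) (.pr s e₂)))

/-- The encoding of the meaning of a probability expression. -/
noncomputable def Expr.semantics (M : MDP S Act AP) : Expr AP n → SMT S Act AP n
  | .prob ψ => ψ.semantics M
  | .const c => .conj (states S n) fun s => .eq (.pr s (.const c)) (.const c)
  | .add e₁ e₂ =>
      .and (.and (e₁.semantics M) (e₂.semantics M)) <|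
        .conj (states S n) fun s => .eq (.pr s (.add e₁ e₂)) (.add (.pr s e₁) (.pr s e₂))
  | .sub e₁ e₂ =>
      .and (.and (e₁.semantics M) (e₂.semantics M)) <|
        .conj (states S n) fun s => .eq (.pr s (.sub e₁ e₂)) (.sub (.pr s e₁) (.pr s e₂))
  | .mul e₁ e₂ =>
      .and (.and (e₁.semantics M) (e₂.semantics M)) <|
        .conj (states S n) fun s => .eq (.pr s (.mul e₁ e₂)) (.mul (.pr s e₁) (.pr s e₂))

/-- The encoding of the meaning of the expression `ℙ(ψ)` for a path formula `ψ`. -/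
noncomputable def PathForm.semantics (M : MDP S Act AP) : PathForm AP n → SMT S Act AP n
  | .next φ =>
      .and
        (.and (φ.semantics M) <|
          .conj (states S n) fun s =>
            .or (.and (.eq (.toInt s φ) (.const 1)) (.holds s φ))
              (.and (.eq (.toInt s φ) (.const 0)) (.not (.holds s φ)))) <|
        .conj (states S n) fun s => .conj (M.enabledVec s) fun α =>
          .imp (chosen s α)
            (.eq (.pr s (.prob (.next φ))) (succSum M s α fun s' => .toInt s' φ))
  | .unt φ₁ φ₂ => semanticsUnboundedUntil M (.and (φ₁.semantics M) (φ₂.semantics M)) φ₁ φ₂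
  | .bunt φ₁ φ₂ k₁ k₂ hk =>
      semanticsBoundedUntil M (.and (φ₁.semantics M) (φ₂.semantics M)) φ₁ φ₂ k₁ k₂ hk

end

/-- The encoding of the state quantifiers: `B_1 … B_n F_{(s_1, …, s_n)}`, where `B_i` is a
conjunction or a disjunction over `s_i ∈ S`. -/
noncomputable def quantEnc {m : ℕ} : {n : ℕ} → (Fin n → Quant) → ((Fin n → S) → SMT S Act AP m) →
    SMT S Act AP m
  | 0, _, F => F Fin.elim0
  | _ + 1, Q, F =>
      match Q 0 with
      | .ex => .disj Finset.univ fun s : S => quantEnc (fun i => Q i.succ) fun v => F (Fin.cons s v)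
      | .all => .conj Finset.univ fun s : S => quantEnc (fun i => Q i.succ) fun v => F (Fin.cons s v)

/-- The encoding of the truth of `∃ σ̂. Q_1 ŝ_1(σ̂). … Q_n ŝ_n(σ̂). φ`. -/
noncomputable def truthEnc (Q : Fin n → Quant) (φ : Form AP n) : SMT S Act AP n :=
  quantEnc Q fun s => .holds s φ

/-- `⋀_{s ∈ S} ⋁_{α ∈ Act(s)} σ_s = α`. -/
noncomputable def schedulerChoice (M : MDP S Act AP) : SMT S Act AP n :=
  .conj Finset.univ fun s => .disj (M.enabled s) fun α => .schedEq s α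

/-- The SMT formula that the main algorithm builds and checks. -/
noncomputable def encoding (M : MDP S Act AP) (Φ : Formula AP n) : SMT S Act AP n :=
  match Φ.schedQ with
  | .ex => .and (.and (schedulerChoice M) (Φ.body.semantics M)) (truthEnc Φ.stateQ Φ.body)
  | .all =>
      .and (.and (schedulerChoice M) (Form.semantics M (.neg Φ.body)))
        (truthEnc (fun i => (Φ.stateQ i).dual) (.neg Φ.body))

open Classical in
/-- The answer of the main algorithm. -/
noncomputable def mainAlgorithm (D : Type*) [LinearOrder D] (M : MDP S Act AP)
    (Φ : Formula AP n) : Bool :=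
  match Φ.schedQ with
  | .ex => if (encoding M Φ).Satisfiable D then true else false
  | .all => if (encoding M Φ).Satisfiable D then false else true

end Encoding

/-! ### Unbounded until probabilities as a fixed point -/

section Until

variable {AP T : Type*} {n : ℕ}

mutual

/-- The pairs `(φ₁, φ₂)` such that `ℙ(φ₁ U φ₂)` occurs in the formula. -/
def Form.untils : Form AP n → Set (Form AP n × Form AP n)
  | .tru => ∅
  | .atom _ _ => ∅
  | .and φ₁ φ₂ => φ₁.untils ∪ φ₂.untils
  | .neg φ => φ.untils
  | .lt e₁ e₂ => e₁.untils ∪ e₂.untils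

/-- The pairs `(φ₁, φ₂)` such that `ℙ(φ₁ U φ₂)` occurs in the expression. -/
def Expr.untils : Expr AP n → Set (Form AP n × Form AP n)
  | .prob ψ => ψ.untils
  | .const _ => ∅
  | .add e₁ e₂ => e₁.untils ∪ e₂.untils
  | .sub e₁ e₂ => e₁.untils ∪ e₂.untils
  | .mul e₁ e₂ => e₁.untils ∪ e₂.untils

/-- The pairs `(φ₁, φ₂)` such that `ℙ(φ₁ U φ₂)` occurs in `ℙ(ψ)`. -/
def PathForm.untils : PathForm AP n → Set (Form AP n × Form AP n)
  | .next φ => φ.untils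
  | .unt φ₁ φ₂ => insert (φ₁, φ₂) (φ₁.untils ∪ φ₂.untils)
  | .bunt φ₁ φ₂ _ _ _ => φ₁.untils ∪ φ₂.untils

end

open Classical in
/-- The operator of the equation system for the probabilities of `A U B` in a Markov chain. -/
noncomputable def untilOp [Fintype T] (C : DTMC T AP) (A B : T → Prop) (p : T → ℝ) : T → ℝ :=
  fun t => if B t then 1 else if A t then ∑ t', C.P t t' * p t' else 0

end Until

end HyperPCTL

/-!
By the Markov property the path measure from `t` is the mixture, over the successors `t'` of `t`, of
the path measures from `t'` prefixed by `t`. Hence the probabilities of `A U B` solve the equation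
system `untilOp`, and as limits of the probabilities of `A U^[0,k] B` they are its least nonnegative
solution. In general there are larger solutions. The distance variables exclude them: a state where
the difference to the least solution is maximal has, by the maximum principle, only successors of
this kind, whereas the distances force some successor to satisfy `B` or to have a smaller distance.
So a solution of the constraints agrees with the semantics under the scheduler that it chooses.
Conversely, the semantic values together with the actual distances to the right operand form a
solution, and since only the order of the distances matters, `|S|^n` values are enough for them.
-/

namespace HyperPCTL

open MeasureTheory ProbabilityTheory Preorder Filter Topology

/-! ### Path measures -/

section PathMeasure

variable {T AP : Type*}

/-- The paths that agree with `x` up to and including time `m`; these cylinders generate the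
σ-algebra of path events. -/
def prefixCylinder (m : ℕ) (x : ℕ → T) : Set (ℕ → T) := {π | ∀ i ≤ m, π i = x i}

/-- The path `t π_0 π_1 …`: it moves events between the chain started in `t` and the chain started
in a successor of `t`. -/
def consPath (t : T) (π : ℕ → T) : ℕ → T
  | 0 => t
  | k + 1 => π k

lemma prefixCylinder_eq_preimage (m : ℕ) (x : ℕ → T) :
    prefixCylinder m x = frestrictLe (π := fun _ => T) m ⁻¹' {frestrictLe m x} := by
  ext π
  simp [prefixCylinder, funext_iff]

lemma prefixCylinder_succ_eq_preimage (m : ℕ) (x : ℕ → T) :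
    prefixCylinder (m + 1) x =
      (fun π : ℕ → T => (frestrictLe (π := fun _ => T) m π, π (m + 1))) ⁻¹'
        ({frestrictLe m x} ×ˢ {x (m + 1)}) := by
  ext π
  simp [prefixCylinder, funext_iff, Nat.le_succ_iff, or_imp, forall_and]

lemma consPath_preimage_prefixCylinder (x : ℕ → T) (m : ℕ) :
    consPath (x 0) ⁻¹' prefixCylinder (m + 1) x = prefixCylinder m fun i => x (i + 1) := by
  ext π
  simp only [prefixCylinder, Set.mem_preimage, Set.mem_ofPred_eq]
  rw [← Nat.and_forall_add_one]
  simp [consPath]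

lemma consPath_preimage_prefixCylinder_of_ne {t : T} {x : ℕ → T} (h : t ≠ x 0) (m : ℕ) :
    consPath t ⁻¹' prefixCylinder m x = ∅ :=
  Set.eq_empty_of_forall_notMem fun _ hπ => h (hπ 0 m.zero_le)

variable [MeasurableSpace T]

lemma measurable_consPath (t : T) : Measurable (consPath t) := by
  rw [measurable_pi_iff]
  rintro (_ | k)
  · exact measurable_const
  · exact measurable_pi_apply k

variable [DiscreteMeasurableSpace T]

lemma measurableSet_prefixCylinder [Countable T] (m : ℕ) (x : ℕ → T) :
    MeasurableSet (prefixCylinder m x) := by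
  rw [prefixCylinder_eq_preimage]
  exact measurable_frestrictLe m (measurableSet_singleton _)

lemma measure_ext_of_prefixCylinder [Countable T] {μ ν : Measure (ℕ → T)} [IsFiniteMeasure μ]
    (h : ∀ m x, μ (prefixCylinder (m + 1) x) = ν (prefixCylinder (m + 1) x)) : μ = ν := by
  have map_eq : ∀ m, 1 ≤ m → ν.map (frestrictLe (π := fun _ => T) m) =
      μ.map (frestrictLe (π := fun _ => T) m) := by
    intro m hm
    obtain ⟨m, rfl⟩ := Nat.exists_eq_add_of_le' hm
    refine Measure.ext_of_singleton fun y => ?_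
    let x : ℕ → T := fun i =>
      if hi : i ≤ m + 1 then y ⟨i, Finset.mem_Iic.2 hi⟩ else y ⟨0, Finset.mem_Iic.2 (Nat.zero_le _)⟩
    have hx : frestrictLe (π := fun _ => T) (m + 1) x = y := by
      ext ⟨i, hi⟩
      simp [x, Finset.mem_Iic.1 hi]
    rw [Measure.map_apply (measurable_frestrictLe _) (measurableSet_singleton y),
      Measure.map_apply (measurable_frestrictLe _) (measurableSet_singleton y), ← hx,
      ← prefixCylinder_eq_preimage, h]
  have marginals : IsProjectiveMeasureFamily (α := fun _ : ℕ => T) fun I => μ.map I.restrict := by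
    intro I J hJI
    exact (Measure.map_map (Finset.measurable_restrict₂ hJI) (Finset.measurable_restrict I)).symm
  have hμ : IsProjectiveLimit μ fun I => μ.map I.restrict := fun _ => rfl
  exact hμ.unique ((isProjectiveLimit_nat_iff' marginals ν 1).2 map_eq)

variable [Fintype T] (C : DTMC T AP)

instance DTMC.isProbabilityMeasure_pathMeasure (t : T) :
    IsProbabilityMeasure (C.pathMeasure t) := by
  unfold DTMC.pathMeasure; infer_instance

lemma DTMC.stepKernel_singleton (t t' : T) :
    C.stepKernel t {t'} = ENNReal.ofReal (C.P t t') :=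
  PMF.toMeasure_apply_singleton _ _ (measurableSet_singleton t')

lemma DTMC.map_frestrictLe_zero_pathMeasure (t : T) :
    (C.pathMeasure t).map (frestrictLe (π := fun _ => T) 0) = Measure.dirac fun _ => t := by
  rw [DTMC.pathMeasure, Kernel.traj_map_frestrictLe_apply, Kernel.partialTraj_self,
    Kernel.id_apply]

lemma DTMC.pathMeasure_prefixCylinder_succ (t : T) (m : ℕ) (x : ℕ → T) :
    C.pathMeasure t (prefixCylinder (m + 1) x) =
      C.pathMeasure t (prefixCylinder m x) * ENNReal.ofReal (C.P (x m) (x (m + 1))) := by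
  have step := Kernel.partialTraj_compProd_eq_map_traj (X := fun _ => T) (κ := C.histKernel)
    (Nat.zero_le m) (x₀ := fun _ => t)
  rw [prefixCylinder_succ_eq_preimage, DTMC.pathMeasure, ← Measure.map_apply (by fun_prop)
    ((measurableSet_singleton _).prod (measurableSet_singleton _)), ← step,
    Measure.compProd_apply_prod (measurableSet_singleton _) (measurableSet_singleton _),
    lintegral_singleton, prefixCylinder_eq_preimage,
    ← Measure.map_apply (measurable_frestrictLe m) (measurableSet_singleton _),
    Kernel.traj_map_frestrictLe_apply, mul_comm, DTMC.histKernel, Kernel.comap_apply,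
    DTMC.stepKernel_singleton]
  rfl

open Classical in
lemma DTMC.pathMeasure_prefixCylinder (t : T) (m : ℕ) (x : ℕ → T) :
    C.pathMeasure t (prefixCylinder m x) =
      if t = x 0 then ∏ i ∈ Finset.range m, ENNReal.ofReal (C.P (x i) (x (i + 1))) else 0 := by
  induction m with
  | zero =>
    rw [prefixCylinder_eq_preimage, ← Measure.map_apply (measurable_frestrictLe 0)
      (measurableSet_singleton _), C.map_frestrictLe_zero_pathMeasure,
      Measure.dirac_apply' _ (measurableSet_singleton _)]
    simp [Set.indicator_apply, funext_iff]
  | succ m ih => rw [C.pathMeasure_prefixCylinder_succ, ih, Finset.prod_range_succ, ite_zero_mul]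

open Classical in
theorem DTMC.pathMeasure_eq_sum_map_consPath (t : T) :
    C.pathMeasure t = ∑ t', ENNReal.ofReal (C.P t t') • (C.pathMeasure t').map (consPath t) := by
  refine measure_ext_of_prefixCylinder fun m x => ?_
  simp only [Measure.coe_finsetSum, Finset.sum_apply, Measure.smul_apply, smul_eq_mul,
    Measure.map_apply (measurable_consPath t) (measurableSet_prefixCylinder _ _)]
  obtain rfl | h := eq_or_ne t (x 0)
  · simp [consPath_preimage_prefixCylinder, C.pathMeasure_prefixCylinder, Finset.prod_range_succ',
      mul_comm]
  · simp [consPath_preimage_prefixCylinder_of_ne h, C.pathMeasure_prefixCylinder, h]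

end PathMeasure

/-! ### Until probabilities -/

section PathSets

variable {T : Type*} {A B : T → Prop}

/-- The event `A U B`. -/
def untilPaths (A B : T → Prop) : Set (ℕ → T) := {π | ∃ j, B (π j) ∧ ∀ i < j, A (π i)}

/-- The event `A U^[k₁, k₂] B`. -/
def boundedUntilPaths (A B : T → Prop) (k₁ k₂ : ℕ) : Set (ℕ → T) :=
  {π | ∃ j, k₁ ≤ j ∧ j ≤ k₂ ∧ B (π j) ∧ ∀ i < j, A (π i)}

lemma consPath_mem_untilPaths {t : T} {π : ℕ → T} :
    consPath t π ∈ untilPaths A B ↔ B t ∨ A t ∧ π ∈ untilPaths A B := by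
  simp only [untilPaths, Set.mem_ofPred_eq]
  rw [← Nat.or_exists_add_one]
  simp only [Nat.forall_lt_succ_left, consPath]
  simp [and_left_comm]

lemma consPath_mem_boundedUntilPaths_zero_zero {t : T} {π : ℕ → T} :
    consPath t π ∈ boundedUntilPaths A B 0 0 ↔ B t := by
  simp [boundedUntilPaths, consPath]

lemma consPath_mem_boundedUntilPaths_zero_succ {k : ℕ} {t : T} {π : ℕ → T} :
    consPath t π ∈ boundedUntilPaths A B 0 (k + 1) ↔
      B t ∨ A t ∧ π ∈ boundedUntilPaths A B 0 k := by
  simp only [boundedUntilPaths, Set.mem_ofPred_eq]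
  rw [← Nat.or_exists_add_one]
  simp only [Nat.forall_lt_succ_left, consPath]
  simp [and_left_comm]

lemma consPath_mem_boundedUntilPaths_succ_succ {k₁ k₂ : ℕ} {t : T} {π : ℕ → T} :
    consPath t π ∈ boundedUntilPaths A B (k₁ + 1) (k₂ + 1) ↔
      A t ∧ π ∈ boundedUntilPaths A B k₁ k₂ := by
  simp only [boundedUntilPaths, Set.mem_ofPred_eq]
  rw [← Nat.or_exists_add_one]
  simp only [Nat.forall_lt_succ_left, consPath]
  simp [and_left_comm]

lemma untilPaths_eq_iUnion (A B : T → Prop) :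
    untilPaths A B = ⋃ k, boundedUntilPaths A B 0 k := by
  ext π
  simp only [Set.mem_iUnion]
  exact ⟨fun ⟨j, h⟩ => ⟨j, j, Nat.zero_le j, le_rfl, h⟩, fun ⟨_, j, _, _, h⟩ => ⟨j, h⟩⟩

lemma monotone_boundedUntilPaths (A B : T → Prop) : Monotone (boundedUntilPaths A B 0) :=
  fun _ _ hk _ ⟨j, h₀, hj, h⟩ => ⟨j, h₀, hj.trans hk, h⟩

lemma boundedUntilPaths_mono_left {A' : T → Prop} (h : ∀ t, A t → A' t) (k₁ k₂ : ℕ) :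
    boundedUntilPaths A B k₁ k₂ ⊆ boundedUntilPaths A' B k₁ k₂ :=
  fun _ ⟨j, h₁, h₂, hB, hA⟩ => ⟨j, h₁, h₂, hB, fun i hi => h _ (hA i hi)⟩

variable [MeasurableSpace T] [DiscreteMeasurableSpace T]

lemma measurableSet_boundedUntilPaths (A B : T → Prop) (k₁ k₂ : ℕ) :
    MeasurableSet (boundedUntilPaths A B k₁ k₂) := by
  have hA : Measurable A := .of_discrete
  have hB : Measurable B := .of_discrete
  exact measurableSet_setOfPred.2 (by fun_prop)

lemma measurableSet_untilPaths (A B : T → Prop) : MeasurableSet (untilPaths A B) :=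
  untilPaths_eq_iUnion A B ▸ .iUnion fun k => measurableSet_boundedUntilPaths A B 0 k

end PathSets

section Probabilities

variable {T AP : Type*} [Fintype T] (C : DTMC T AP)

lemma DTMC.prob_mem_Icc (t : T) (E : Set (ℕ → T)) : C.prob t E ∈ Set.Icc (0 : ℝ) 1 := by
  let _ : MeasurableSpace T := ⊤
  have : DiscreteMeasurableSpace T := ⟨fun _ => trivial⟩
  exact ⟨measureReal_nonneg, measureReal_le_one⟩

lemma DTMC.prob_mono (t : T) {E F : Set (ℕ → T)} (h : E ⊆ F) : C.prob t E ≤ C.prob t F := by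
  let _ : MeasurableSpace T := ⊤
  have : DiscreteMeasurableSpace T := ⟨fun _ => trivial⟩
  exact measureReal_mono h

lemma DTMC.prob_univ (t : T) : C.prob t Set.univ = 1 := by
  let _ : MeasurableSpace T := ⊤
  have : DiscreteMeasurableSpace T := ⟨fun _ => trivial⟩
  exact probReal_univ

lemma DTMC.prob_empty (t : T) : C.prob t ∅ = 0 := by
  let _ : MeasurableSpace T := ⊤
  have : DiscreteMeasurableSpace T := ⟨fun _ => trivial⟩
  exact measureReal_empty

lemma DTMC.tendsto_prob_iUnion (t : T) {E : ℕ → Set (ℕ → T)} (hE : Monotone E) :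
    Tendsto (fun k => C.prob t (E k)) atTop (𝓝 (C.prob t (⋃ k, E k))) := by
  let _ : MeasurableSpace T := ⊤
  have : DiscreteMeasurableSpace T := ⟨fun _ => trivial⟩
  exact (ENNReal.tendsto_toReal (measure_ne_top _ _)).comp
    (tendsto_measure_iUnion_atTop (μ := C.pathMeasure t) hE)

theorem DTMC.prob_eq_sum (t : T) {E : Set (ℕ → T)}
    (hE : ∀ [MeasurableSpace T] [DiscreteMeasurableSpace T], MeasurableSet E) :
    C.prob t E = ∑ t', C.P t t' * C.prob t' (consPath t ⁻¹' E) := by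
  let _ : MeasurableSpace T := ⊤
  have : DiscreteMeasurableSpace T := ⟨fun _ => trivial⟩
  simp only [DTMC.prob, measureReal_def]
  rw [C.pathMeasure_eq_sum_map_consPath t, Measure.finsetSum_apply, ENNReal.toReal_sum]
  · simp [ENNReal.toReal_ofReal (C.nonneg t _), Measure.map_apply (measurable_consPath t) hE]
  · exact fun t' _ => ENNReal.mul_ne_top ENNReal.ofReal_ne_top (measure_ne_top _ _)

open Classical in
lemma DTMC.prob_eq_ite {t : T} {E F : Set (ℕ → T)} {b a : Prop}
    (hE : ∀ [MeasurableSpace T] [DiscreteMeasurableSpace T], MeasurableSet E)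
    (h : ∀ π, consPath t π ∈ E ↔ b ∨ a ∧ π ∈ F) :
    C.prob t E = if b then 1 else if a then ∑ t', C.P t t' * C.prob t' F else 0 := by
  have preimage : consPath t ⁻¹' E = {π | b ∨ a ∧ π ∈ F} := Set.ext h
  rw [C.prob_eq_sum t hE, preimage]
  split_ifs with hb ha
  · simp [hb, C.prob_univ, C.sum_P]
  · simp [hb, ha]
  · simp [hb, ha, C.prob_empty]

open Classical in
lemma DTMC.prob_next (A : T → Prop) (t : T) :
    C.prob t {π | A (π 1)} = ∑ t', C.P t t' * if A t' then 1 else 0 := by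
  have measurableSet_apply (i : ℕ) [MeasurableSpace T] [DiscreteMeasurableSpace T] :
      MeasurableSet {π : ℕ → T | A (π i)} := by
    have hA : Measurable A := .of_discrete
    exact measurableSet_setOfPred.2 (by fun_prop)
  have prob_start (t' : T) : C.prob t' {π | A (π 0)} = if A t' then 1 else 0 := by
    rw [C.prob_eq_ite (b := A t') (a := False) (F := ∅) (measurableSet_apply 0)
      (by simp [consPath]), if_neg not_false]
  simp only [← prob_start]
  exact C.prob_eq_sum t (measurableSet_apply 1)

variable (A B : T → Prop)

lemma DTMC.untilOp_prob_untilPaths :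
    untilOp C A B (fun t => C.prob t (untilPaths A B)) = fun t => C.prob t (untilPaths A B) :=
  funext fun _ =>
    (C.prob_eq_ite (measurableSet_untilPaths A B) fun _ => consPath_mem_untilPaths).symm

open Classical in
lemma DTMC.prob_boundedUntilPaths_zero_zero (t : T) :
    C.prob t (boundedUntilPaths A B 0 0) = if B t then 1 else 0 := by
  rw [C.prob_eq_ite (b := B t) (a := False) (F := ∅) (measurableSet_boundedUntilPaths A B 0 0)
    (by simp [consPath_mem_boundedUntilPaths_zero_zero]), if_neg not_false]

lemma DTMC.prob_boundedUntilPaths_zero_succ (k : ℕ) (t : T) :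
    C.prob t (boundedUntilPaths A B 0 (k + 1)) =
      untilOp C A B (fun t' => C.prob t' (boundedUntilPaths A B 0 k)) t :=
  C.prob_eq_ite (measurableSet_boundedUntilPaths A B 0 (k + 1))
    fun _ => consPath_mem_boundedUntilPaths_zero_succ

open Classical in
lemma DTMC.prob_boundedUntilPaths_succ_succ (k₁ k₂ : ℕ) (t : T) :
    C.prob t (boundedUntilPaths A B (k₁ + 1) (k₂ + 1)) =
      if A t then ∑ t', C.P t t' * C.prob t' (boundedUntilPaths A B k₁ k₂) else 0 := by
  rw [C.prob_eq_ite (b := False) (a := A t) (F := boundedUntilPaths A B k₁ k₂)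
    (measurableSet_boundedUntilPaths A B _ _)
    (by simp [consPath_mem_boundedUntilPaths_succ_succ]), if_neg not_false]

lemma DTMC.tendsto_prob_boundedUntilPaths (t : T) :
    Tendsto (fun k => C.prob t (boundedUntilPaths A B 0 k)) atTop
      (𝓝 (C.prob t (untilPaths A B))) :=
  untilPaths_eq_iUnion A B ▸ C.tendsto_prob_iUnion t (monotone_boundedUntilPaths A B)

end Probabilities

section FixedPoint

variable {T AP : Type*} [Fintype T] (C : DTMC T AP) {A B : T → Prop}

lemma untilOp_mono (A B : T → Prop) : Monotone (untilOp C A B) := by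
  intro p q h t
  unfold untilOp
  split_ifs
  · exact le_rfl
  · exact Finset.sum_le_sum fun t' _ => mul_le_mul_of_nonneg_left (h t') (C.nonneg t t')
  · exact le_rfl

lemma DTMC.prob_untilPaths_le_of_untilOp_le {p : T → ℝ} (hp₀ : 0 ≤ p)
    (hp : untilOp C A B p ≤ p) (t : T) : C.prob t (untilPaths A B) ≤ p t := by
  refine le_of_tendsto' (C.tendsto_prob_boundedUntilPaths A B t) fun k => ?_
  induction k generalizing t with
  | zero =>
    rw [C.prob_boundedUntilPaths_zero_zero]
    split_ifs with hB
    · simpa [untilOp, hB] using hp t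
    · exact hp₀ t
  | succ k ih =>
    rw [C.prob_boundedUntilPaths_zero_succ]
    exact (untilOp_mono C A B ih t).trans (hp t)

theorem DTMC.isLeast_prob_untilPaths (A B : T → Prop) :
    IsLeast {p : T → ℝ | (∀ t, p t ∈ Set.Icc (0 : ℝ) 1) ∧ untilOp C A B p = p}
      (fun t => C.prob t (untilPaths A B)) :=
  ⟨⟨fun _ => C.prob_mem_Icc _ _, C.untilOp_prob_untilPaths A B⟩,
    fun _ ⟨hp₀, hp⟩ => C.prob_untilPaths_le_of_untilOp_le (fun t => (hp₀ t).1) hp.le⟩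

lemma DTMC.eq_of_forall_le_of_le_sum {f : T → ℝ} {t t' : T} (hmax : ∀ u, f u ≤ f t)
    (ht : f t ≤ ∑ u, C.P t u * f u) (ht' : 0 < C.P t t') : f t' = f t := by
  by_contra hne
  have lt : ∑ u, C.P t u * f u < ∑ u, C.P t u * f t :=
    Finset.sum_lt_sum (fun u _ => mul_le_mul_of_nonneg_left (hmax u) (C.nonneg t u))
      ⟨t', Finset.mem_univ t', mul_lt_mul_of_pos_left (lt_of_le_of_ne (hmax t') hne) ht'⟩
  rw [← Finset.sum_mul, C.sum_P, one_mul] at lt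
  exact ht.not_gt lt

lemma DTMC.undecided_of_lt {p q : T → ℝ} (hp : p ≤ untilOp C A B p) (hq : untilOp C A B q ≤ q)
    {t : T} (hlt : q t < p t) :
    A t ∧ ¬ B t ∧ p t - q t ≤ ∑ t', C.P t t' * (p t' - q t') := by
  have hpt := hp t
  have hqt := hq t
  unfold untilOp at hpt hqt
  split_ifs at hpt hqt with hB hA
  · linarith
  · refine ⟨hA, hB, ?_⟩
    simp only [mul_sub, Finset.sum_sub_distrib]
    linarith
  · linarith

/-- A state of minimal rank among those where `p - q` is maximal has a successor that is decided or
of smaller rank, but by the maximum principle `p - q` is maximal there as well. -/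
theorem DTMC.le_of_le_untilOp_of_untilOp_le_of_rank {α : Type*} [LinearOrder α] {p q : T → ℝ}
    (hp : p ≤ untilOp C A B p) (hq : untilOp C A B q ≤ q) (d : T → α)
    (hd : ∀ t, A t → ¬ B t → q t < p t → ∃ t', 0 < C.P t t' ∧ (B t' ∨ d t' < d t)) : p ≤ q := by
  intro t
  by_contra! hlt
  have : Nonempty T := ⟨t⟩
  obtain ⟨m, hm⟩ := Finite.exists_max (p - q)
  obtain ⟨r, hr, hmin⟩ :=
    Set.exists_min_image {s | (p - q) s = (p - q) m} d (Set.toFinite _) ⟨m, rfl⟩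
  have undecided : ∀ s, (p - q) s = (p - q) m →
      A s ∧ ¬ B s ∧ q s < p s ∧ (p - q) s ≤ ∑ s', C.P s s' * (p - q) s' := by
    intro s hs
    have hlt_s : q s < p s := sub_pos.1 (((sub_pos.2 hlt).trans_le (hm t)).trans_eq hs.symm)
    obtain ⟨hA, hB, hsum⟩ := C.undecided_of_lt hp hq hlt_s
    exact ⟨hA, hB, hlt_s, hsum⟩
  obtain ⟨hA, hB, hlt_r, hsum⟩ := undecided r hr
  obtain ⟨r', hstep, hr'⟩ := hd r hA hB hlt_r
  have hmax : (p - q) r' = (p - q) m :=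
    (C.eq_of_forall_le_of_le_sum (hr ▸ hm) hsum hstep).trans hr
  rcases hr' with hB' | hd'
  · exact (undecided r' hmax).2.1 hB'
  · exact (hmin r' hmax).not_gt hd'

theorem DTMC.eq_prob_untilPaths_of_rank {α : Type*} [LinearOrder α] {p : T → ℝ} (hp₀ : 0 ≤ p)
    (hp : untilOp C A B p = p) (d : T → α)
    (hd : ∀ t, A t → ¬ B t → 0 < p t → ∃ t', 0 < C.P t t' ∧ (B t' ∨ d t' < d t)) :
    p = fun t => C.prob t (untilPaths A B) := by
  refine le_antisymm ?_ fun t => C.prob_untilPaths_le_of_untilOp_le hp₀ hp.le t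
  refine C.le_of_le_untilOp_of_untilOp_le_of_rank hp.ge (C.untilOp_prob_untilPaths A B).le d ?_
  exact fun t hA hB hlt => hd t hA hB ((C.prob_mem_Icc _ _).1.trans_lt hlt)

end FixedPoint

section Rank

variable {T AP : Type*} [Fintype T] (C : DTMC T AP)

/-- The least number of steps within which `B` is reached with positive probability, `0` if `B` is
unreachable. The left operand of the until formula is ignored since the distance variables of the
encoding are shared by all until formulas with the same right operand. -/
noncomputable def DTMC.distTo (B : T → Prop) (t : T) : ℕ :=
  sInf {k | 0 < C.prob t (boundedUntilPaths (fun _ => True) B 0 k)}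

lemma DTMC.exists_step_distTo_lt {A B : T → Prop} {t : T} (hB : ¬ B t)
    (hpos : 0 < C.prob t (untilPaths A B)) : ∃ t', 0 < C.P t t' ∧ C.distTo B t' < C.distTo B t := by
  obtain ⟨j, hj⟩ := ((C.tendsto_prob_boundedUntilPaths A B t).eventually_const_lt hpos).exists
  have reachable : {k | 0 < C.prob t (boundedUntilPaths (fun _ => True) B 0 k)}.Nonempty :=
    ⟨j, hj.trans_le (C.prob_mono t (boundedUntilPaths_mono_left (fun _ _ => trivial) 0 j))⟩
  have reach : 0 < C.prob t (boundedUntilPaths (fun _ => True) B 0 (C.distTo B t)) :=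
    Nat.sInf_mem reachable
  rcases hk : C.distTo B t with _ | k
  · simp [hk, C.prob_boundedUntilPaths_zero_zero, hB] at reach
  · have sum_pos : 0 < ∑ t', C.P t t' * C.prob t' (boundedUntilPaths (fun _ => True) B 0 k) := by
      simpa [hk, C.prob_boundedUntilPaths_zero_succ, untilOp, hB] using reach
    obtain ⟨t', -, ht'⟩ :=
      Finset.exists_lt_of_sum_lt (f := fun _ => (0 : ℝ)) (by simpa using sum_pos)
    have step : 0 < C.P t t' := (C.nonneg t t').lt_of_ne' (left_ne_zero_of_mul ht'.ne')
    exact ⟨t', step, Nat.lt_succ_of_le (Nat.sInf_le (pos_of_mul_pos_right ht' step.le))⟩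

open Classical in
/-- The number of elements of smaller rank: it compresses a rank function into one that a linear
order with at least as many elements as `T` can represent. -/
noncomputable def finRank {α : Type*} [Preorder α] (r : T → α) (t : T) : Fin (Fintype.card T) :=
  ⟨(Finset.univ.filter fun s => r s < r t).card,
    Finset.card_lt_univ_of_notMem (x := t) (by simp)⟩

lemma finRank_lt_finRank {α : Type*} [Preorder α] {r : T → α} {s t : T} (h : r s < r t) :
    finRank r s < finRank r t := by
  classical
  refine Fin.mk_lt_mk.2 (Finset.card_lt_card (Finset.ssubset_iff_of_subset ?_ |>.2 ⟨s, ?_⟩))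
  · exact Finset.monotone_filter_right _ fun u _ hu => hu.trans h
  · simp [h]

end Rank

/-! ### Meaning of the constraints -/

section Interpretation

variable {S Act AP D : Type*} {n : ℕ} (ν : Assignment S Act AP n D)

lemma Term.eval_sum {ι : Type*} (I : Finset ι) (t : ι → Term S AP n) :
    (Term.sum I t).eval ν = ∑ i ∈ I, (t i).eval ν := by
  rw [Term.sum, ← Finset.sum_map_toList]
  induction I.toList with
  | nil => rfl
  | cons i l ih => simp [Term.eval, ih]

variable [LinearOrder D]

lemma SMT.holds_conj {ι : Type*} (I : Finset ι) (F : ι → SMT S Act AP n) :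
    (SMT.conj I F).Holds ν ↔ ∀ i ∈ I, (F i).Holds ν := by
  simp only [SMT.conj, ← Finset.mem_toList]
  induction I.toList with
  | nil => simp [SMT.Holds]
  | cons i l ih => simp [SMT.Holds, ih]

lemma SMT.holds_disj {ι : Type*} (I : Finset ι) (F : ι → SMT S Act AP n) :
    (SMT.disj I F).Holds ν ↔ ∃ i ∈ I, (F i).Holds ν := by
  simp only [SMT.disj, ← Finset.mem_toList]
  induction I.toList with
  | nil => simp [SMT.Holds]
  | cons i l ih => simp [SMT.Holds, ih]

lemma mem_states [Fintype S] (s : Fin n → S) : s ∈ states S n := Finset.mem_univ s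

lemma holds_chosen (s : Fin n → S) (α : Fin n → Act) :
    (chosen s α : SMT S Act AP n).Holds ν ↔ α = fun i => ν.sched (s i) := by
  simp [chosen, SMT.holds_conj, SMT.Holds, funext_iff, eq_comm]

lemma holds_quantEnc [Fintype S] {m : ℕ} (Q : Fin m → Quant)
    (F : (Fin m → S) → SMT S Act AP n) :
    (quantEnc Q F).Holds ν ↔ StatePrefix Q fun s => (F s).Holds ν := by
  induction m with
  | zero => rfl
  | succ m ih =>
    cases h : Q 0 <;> simp [quantEnc, StatePrefix, h, SMT.holds_conj, SMT.holds_disj, ih]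

lemma holds_truthEnc [Fintype S] (Q : Fin n → Quant) (φ : Form AP n) :
    (truthEnc Q φ).Holds ν ↔ StatePrefix Q fun s => ν.holds s φ :=
  holds_quantEnc ν Q _

lemma holds_schedulerChoice [Fintype S] [Fintype Act] (M : MDP S Act AP) :
    (schedulerChoice M).Holds ν ↔ ∀ s, ν.sched s ∈ M.enabled s := by
  simp [schedulerChoice, SMT.holds_conj, SMT.holds_disj, SMT.Holds]

end Interpretation

lemma Quant.dual_ex : Quant.ex.dual = .all := rfl

lemma Quant.dual_all : Quant.all.dual = .ex := rfl

lemma statePrefix_dual_not {S : Type*} {n : ℕ} (Q : Fin n → Quant) (p : (Fin n → S) → Prop) :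
    StatePrefix (fun i => (Q i).dual) (fun s => ¬ p s) ↔ ¬ StatePrefix Q p := by
  induction n with
  | zero => rfl
  | succ n ih => cases h : Q 0 <;> simp [StatePrefix, h, Quant.dual_ex, Quant.dual_all, ih]

section Chain

variable {S Act AP D : Type*} [Fintype S] [Fintype Act] {n : ℕ} {M : MDP S Act AP}
  (ν : Assignment S Act AP n D) (hν : ∀ s, ν.sched s ∈ M.enabled s)

/-- The self-composition of `M` under the scheduler that the values of the variables `σ_s` form. -/
noncomputable def Assignment.chain : DTMC (Fin n → S) (AP × Fin n) :=
  M.selfComp ⟨ν.sched, hν⟩ n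

lemma mem_suppVec_iff (s s' : Fin n → S) :
    s' ∈ M.suppVec s (fun i => ν.sched (s i)) ↔ 0 < (ν.chain hν).P s s' := by
  change _ ↔ 0 < ∏ i, M.P (s i) (ν.sched (s i)) (s' i)
  simp only [MDP.suppVec, Fintype.mem_piFinset, MDP.supp, Finset.mem_filter, Finset.mem_univ,
    true_and]
  refine ⟨fun h => Finset.prod_pos fun i _ => h i, fun h i => ?_⟩
  exact (M.P_mem _ _ _).1.lt_of_ne' (Finset.prod_ne_zero_iff.1 h.ne' i (Finset.mem_univ i))

lemma eval_succSum (s : Fin n → S) (x : (Fin n → S) → Term S AP n) :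
    (succSum M s (fun i => ν.sched (s i)) x).eval ν =
      ∑ s', (ν.chain hν).P s s' * (x s').eval ν := by
  rw [succSum, Term.eval_sum]
  refine Finset.sum_subset (Finset.subset_univ _) fun s' _ hs' => mul_eq_zero_of_left ?_ _
  rw [mem_suppVec_iff ν hν, not_lt] at hs'
  exact le_antisymm hs' ((ν.chain hν).nonneg s s')

variable [LinearOrder D]

lemma forall_enabledVec_chosen_iff (hν : ∀ s, ν.sched s ∈ M.enabled s) (s : Fin n → S)
    (p : (Fin n → Act) → Prop) :
    (∀ α ∈ M.enabledVec s, (chosen s α : SMT S Act AP n).Holds ν → p α) ↔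
      p fun i => ν.sched (s i) := by
  simp only [holds_chosen]
  exact ⟨fun h => h _ (Fintype.mem_piFinset.2 fun i => hν (s i)) rfl, fun h _ _ hα => hα ▸ h⟩

lemma forall_enabledVec_and_chosen_iff (hν : ∀ s, ν.sched s ∈ M.enabled s) (s : Fin n → S)
    (a : Prop) (p : (Fin n → Act) → Prop) :
    (∀ α ∈ M.enabledVec s, a ∧ (chosen s α : SMT S Act AP n).Holds ν → p α) ↔
      (a → p fun i => ν.sched (s i)) := by
  rw [← forall_enabledVec_chosen_iff ν hν s fun α => a → p α]
  exact forall₂_congr fun _ _ => by tauto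

end Chain

lemma eq_ite_ite_iff {α : Type*} {A B : Prop} [Decidable A] [Decidable B] {x u v w : α} :
    (x = if B then u else if A then v else w) ↔
      (B → x = u) ∧ (¬ A ∧ ¬ B → x = w) ∧ (A ∧ ¬ B → x = v) := by
  split_ifs <;> simp [*]

section Constraints

variable {S Act AP D : Type*} [Fintype S] [Fintype Act] {n : ℕ} [LinearOrder D]
  {M : MDP S Act AP} {ν : Assignment S Act AP n D}

lemma holds_semantics_tru :
    (Form.semantics M .tru).Holds ν ↔ ∀ s, ν.holds s .tru := by
  simp only [Form.semantics, SMT.holds_conj, mem_states, true_implies, SMT.Holds]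

lemma holds_semantics_atom {a : AP} {i : Fin n} :
    (Form.semantics M (.atom a i)).Holds ν ↔ ∀ s, ν.holds s (.atom a i) ↔ a ∈ M.L (s i) := by
  simp only [Form.semantics, SMT.Holds, SMT.holds_conj, statesWith, Finset.mem_filter,
    Finset.mem_univ, true_and, ← forall_and]
  exact forall_congr' fun s => by tauto

lemma holds_semantics_and {φ₁ φ₂ : Form AP n} :
    (Form.semantics M (.and φ₁ φ₂)).Holds ν ↔ (φ₁.semantics M).Holds ν ∧ (φ₂.semantics M).Holds ν ∧
      ∀ s, ν.holds s (.and φ₁ φ₂) ↔ ν.holds s φ₁ ∧ ν.holds s φ₂ := by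
  simp only [Form.semantics, SMT.Holds, SMT.holds_conj, mem_states, true_implies, and_assoc]
  refine and_congr_right' (and_congr_right' (forall_congr' fun s => ?_))
  tauto

lemma holds_semantics_neg {φ : Form AP n} :
    (Form.semantics M (.neg φ)).Holds ν ↔
      (φ.semantics M).Holds ν ∧ ∀ s, ν.holds s (.neg φ) ↔ ¬ ν.holds s φ := by
  simp only [Form.semantics, SMT.Holds, SMT.holds_conj, mem_states, true_implies, xor_iff_iff_not]

lemma holds_semantics_lt {e₁ e₂ : Expr AP n} :
    (Form.semantics M (.lt e₁ e₂)).Holds ν ↔ (e₁.semantics M).Holds ν ∧ (e₂.semantics M).Holds ν ∧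
      ∀ s, ν.holds s (.lt e₁ e₂) ↔ ν.pr s e₁ < ν.pr s e₂ := by
  simp only [Form.semantics, SMT.Holds, SMT.holds_conj, mem_states, true_implies, Term.eval,
    and_assoc, ge_iff_le, ← not_lt]
  refine and_congr_right' (and_congr_right' (forall_congr' fun s => ?_))
  tauto

lemma holds_semantics_const {c : ℝ} :
    (Expr.semantics M (.const c)).Holds ν ↔ ∀ s, ν.pr s (.const c) = c := by
  simp only [Expr.semantics, SMT.Holds, SMT.holds_conj, mem_states, true_implies, Term.eval]

lemma holds_semantics_add {e₁ e₂ : Expr AP n} :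
    (Expr.semantics M (.add e₁ e₂)).Holds ν ↔ (e₁.semantics M).Holds ν ∧ (e₂.semantics M).Holds ν ∧
      ∀ s, ν.pr s (.add e₁ e₂) = ν.pr s e₁ + ν.pr s e₂ := by
  simp only [Expr.semantics, SMT.Holds, SMT.holds_conj, mem_states, true_implies, Term.eval,
    and_assoc]

lemma holds_semantics_sub {e₁ e₂ : Expr AP n} :
    (Expr.semantics M (.sub e₁ e₂)).Holds ν ↔ (e₁.semantics M).Holds ν ∧ (e₂.semantics M).Holds ν ∧
      ∀ s, ν.pr s (.sub e₁ e₂) = ν.pr s e₁ - ν.pr s e₂ := by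
  simp only [Expr.semantics, SMT.Holds, SMT.holds_conj, mem_states, true_implies, Term.eval,
    and_assoc]

lemma holds_semantics_mul {e₁ e₂ : Expr AP n} :
    (Expr.semantics M (.mul e₁ e₂)).Holds ν ↔ (e₁.semantics M).Holds ν ∧ (e₂.semantics M).Holds ν ∧
      ∀ s, ν.pr s (.mul e₁ e₂) = ν.pr s e₁ * ν.pr s e₂ := by
  simp only [Expr.semantics, SMT.Holds, SMT.holds_conj, mem_states, true_implies, Term.eval,
    and_assoc]

open Classical in
lemma holds_semantics_next (hν : ∀ s, ν.sched s ∈ M.enabled s) {φ : Form AP n} :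
    (PathForm.semantics M (.next φ)).Holds ν ↔ (φ.semantics M).Holds ν ∧
      (∀ s, ν.toInt s φ = if ν.holds s φ then 1 else 0) ∧
      ∀ s, ν.pr s (.prob (.next φ)) = ∑ s', (ν.chain hν).P s s' * ν.toInt s' φ := by
  simp only [PathForm.semantics, SMT.Holds, SMT.holds_conj, mem_states, true_implies, Term.eval,
    forall_enabledVec_chosen_iff ν hν, eval_succSum ν hν, and_assoc]
  refine and_congr_right' (and_congr_left' (forall_congr' fun s => ?_))
  split_ifs with h <;> simp [h]

lemma holds_semanticsUnboundedUntil (hν : ∀ s, ν.sched s ∈ M.enabled s) {base : SMT S Act AP n}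
    {φ₁ φ₂ : Form AP n} :
    (semanticsUnboundedUntil M base φ₁ φ₂).Holds ν ↔ base.Holds ν ∧
      (∀ s, ν.pr s (.prob (.unt φ₁ φ₂)) = untilOp (ν.chain hν) (ν.holds · φ₁) (ν.holds · φ₂)
        (fun s' => ν.pr s' (.prob (.unt φ₁ φ₂))) s) ∧
      ∀ s, ν.holds s φ₁ → ¬ ν.holds s φ₂ → 0 < ν.pr s (.prob (.unt φ₁ φ₂)) →
        ∃ s', 0 < (ν.chain hν).P s s' ∧ (ν.holds s' φ₂ ∨ ν.dist s' φ₂ < ν.dist s φ₂) := by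
  simp only [semanticsUnboundedUntil, SMT.Holds, SMT.holds_conj, mem_states, true_implies,
    SMT.holds_disj, Term.eval, ← and_assoc, forall_enabledVec_and_chosen_iff ν hν,
    eval_succSum ν hν, mem_suppVec_iff ν hν, untilOp, eq_ite_ite_iff, ← forall_and, gt_iff_lt]
  exact and_congr_right' (forall_congr' fun s => by simp only [imp_and, and_imp, and_assoc])

open Classical in
lemma holds_semanticsBoundedUntil_zero {base : SMT S Act AP n} {φ₁ φ₂ : Form AP n} {k₁ : ℕ}
    {hk : k₁ ≤ 0} :
    (semanticsBoundedUntil M base φ₁ φ₂ k₁ 0 hk).Holds ν ↔ base.Holds ν ∧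
      ∀ s, ν.pr s (.prob (.bunt φ₁ φ₂ k₁ 0 hk)) = if ν.holds s φ₂ then 1 else 0 := by
  simp only [semanticsBoundedUntil, SMT.Holds, SMT.holds_conj, mem_states, true_implies, Term.eval]
  refine and_congr_right' (forall_congr' fun s => ?_)
  split_ifs with h <;> simp [h]

lemma holds_semanticsBoundedUntil_zero_succ (hν : ∀ s, ν.sched s ∈ M.enabled s)
    {base : SMT S Act AP n} {φ₁ φ₂ : Form AP n} {k : ℕ} {hk : 0 ≤ k + 1} :
    (semanticsBoundedUntil M base φ₁ φ₂ 0 (k + 1) hk).Holds ν ↔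
      (semanticsBoundedUntil M base φ₁ φ₂ 0 k k.zero_le).Holds ν ∧
      ∀ s, ν.pr s (.prob (.bunt φ₁ φ₂ 0 (k + 1) hk)) =
        untilOp (ν.chain hν) (ν.holds · φ₁) (ν.holds · φ₂)
          (fun s' => ν.pr s' (.prob (.bunt φ₁ φ₂ 0 k k.zero_le))) s := by
  simp only [semanticsBoundedUntil, SMT.Holds, SMT.holds_conj, mem_states, true_implies, Term.eval,
    ← and_assoc, forall_enabledVec_and_chosen_iff ν hν, eval_succSum ν hν, untilOp,
    eq_ite_ite_iff]

open Classical in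
lemma holds_semanticsBoundedUntil_succ_succ (hν : ∀ s, ν.sched s ∈ M.enabled s)
    {base : SMT S Act AP n} {φ₁ φ₂ : Form AP n} {k₁ k₂ : ℕ} {hk : k₁ + 1 ≤ k₂ + 1} :
    (semanticsBoundedUntil M base φ₁ φ₂ (k₁ + 1) (k₂ + 1) hk).Holds ν ↔
      (semanticsBoundedUntil M base φ₁ φ₂ k₁ k₂ (Nat.le_of_succ_le_succ hk)).Holds ν ∧
      ∀ s, ν.pr s (.prob (.bunt φ₁ φ₂ (k₁ + 1) (k₂ + 1) hk)) =
        if ν.holds s φ₁ then ∑ s', (ν.chain hν).P s s' *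
          ν.pr s' (.prob (.bunt φ₁ φ₂ k₁ k₂ (Nat.le_of_succ_le_succ hk))) else 0 := by
  simp only [semanticsBoundedUntil, SMT.Holds, SMT.holds_conj, mem_states, true_implies, Term.eval,
    forall_enabledVec_and_chosen_iff ν hν, eval_succSum ν hν]
  refine and_congr_right' (forall_congr' fun s => ?_)
  split_ifs with h <;> simp [h]

lemma holds_base_of_holds_semanticsBoundedUntil {base : SMT S Act AP n} {φ₁ φ₂ : Form AP n}
    {k₁ k₂ : ℕ} {hk : k₁ ≤ k₂} (h : (semanticsBoundedUntil M base φ₁ φ₂ k₁ k₂ hk).Holds ν) :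
    base.Holds ν := by
  induction k₂ generalizing k₁ with
  | zero => exact (holds_semanticsBoundedUntil_zero.1 h).1
  | succ k₂ ih => cases k₁ <;> exact ih h.1

end Constraints

/-! ### Soundness and completeness of the encoding -/

section PathProbability

variable {AP T : Type*} [Fintype T] {n : ℕ} (C : DTMC T (AP × Fin n))

lemma Expr.val_prob_next (φ : Form AP n) (t : T) :
    (Expr.prob (.next φ)).val C t = C.prob t {π | φ.Sat C (π 1)} := by
  simp only [Expr.val, PathForm.Sat]

lemma Expr.val_prob_unt (φ₁ φ₂ : Form AP n) (t : T) :
    (Expr.prob (.unt φ₁ φ₂)).val C t = C.prob t (untilPaths (φ₁.Sat C) (φ₂.Sat C)) := by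
  simp only [Expr.val, PathForm.Sat, untilPaths]

lemma Expr.val_prob_bunt (φ₁ φ₂ : Form AP n) (k₁ k₂ : ℕ) (hk : k₁ ≤ k₂) (t : T) :
    (Expr.prob (.bunt φ₁ φ₂ k₁ k₂ hk)).val C t =
      C.prob t (boundedUntilPaths (φ₁.Sat C) (φ₂.Sat C) k₁ k₂) := by
  simp only [Expr.val, PathForm.Sat, boundedUntilPaths]

end PathProbability

section Soundness

variable {S Act AP D : Type*} [Fintype S] [Fintype Act] {n : ℕ} [LinearOrder D]
  {M : MDP S Act AP} {ν : Assignment S Act AP n D} (hν : ∀ s, ν.sched s ∈ M.enabled s)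

lemma pr_unt_eq_prob_untilPaths {base : SMT S Act AP n} {φ₁ φ₂ : Form AP n}
    (h : (semanticsUnboundedUntil M base φ₁ φ₂).Holds ν) (s : Fin n → S) :
    ν.pr s (.prob (.unt φ₁ φ₂)) =
      (ν.chain hν).prob s (untilPaths (ν.holds · φ₁) (ν.holds · φ₂)) := by
  obtain ⟨-, fixed_point, progress⟩ := (holds_semanticsUnboundedUntil hν).1 h
  exact congrFun ((ν.chain hν).eq_prob_untilPaths_of_rank
    (p := fun s => ν.pr s (.prob (.unt φ₁ φ₂))) (fun s => (ν.pr_mem s _).1)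
    (funext fun s => (fixed_point s).symm) (ν.dist · φ₂) progress) s

lemma pr_bunt_eq_prob_boundedUntilPaths {base : SMT S Act AP n} {φ₁ φ₂ : Form AP n}
    {k₁ k₂ : ℕ} {hk : k₁ ≤ k₂} (h : (semanticsBoundedUntil M base φ₁ φ₂ k₁ k₂ hk).Holds ν)
    (s : Fin n → S) :
    ν.pr s (.prob (.bunt φ₁ φ₂ k₁ k₂ hk)) =
      (ν.chain hν).prob s (boundedUntilPaths (ν.holds · φ₁) (ν.holds · φ₂) k₁ k₂) := by
  induction k₂ generalizing k₁ s with
  | zero =>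
    obtain rfl := Nat.le_zero.1 hk
    rw [(holds_semanticsBoundedUntil_zero.1 h).2, DTMC.prob_boundedUntilPaths_zero_zero]
  | succ k₂ ih =>
    cases k₁ with
    | zero =>
      obtain ⟨h, pr_eq⟩ := (holds_semanticsBoundedUntil_zero_succ hν).1 h
      rw [pr_eq, funext (ih h), DTMC.prob_boundedUntilPaths_zero_succ]
    | succ k₁ =>
      obtain ⟨h, pr_eq⟩ := (holds_semanticsBoundedUntil_succ_succ hν).1 h
      simp only [pr_eq, ih h, DTMC.prob_boundedUntilPaths_succ_succ]

mutual

theorem Form.holds_iff_sat_of_holds_semantics :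
    ∀ φ : Form AP n, (φ.semantics M).Holds ν → ∀ s, ν.holds s φ ↔ φ.Sat (ν.chain hν) s
  | .tru, h, s => by simp only [holds_semantics_tru.1 h s, Form.Sat]
  | .atom a i, h, s => by
    rw [holds_semantics_atom.1 h s, Form.Sat]
    rfl
  | .and φ₁ φ₂, h, s => by
    obtain ⟨h₁, h₂, holds_and⟩ := holds_semantics_and.1 h
    rw [holds_and, φ₁.holds_iff_sat_of_holds_semantics h₁, φ₂.holds_iff_sat_of_holds_semantics h₂,
      Form.Sat]
  | .neg φ, h, s => by
    obtain ⟨h, holds_neg⟩ := holds_semantics_neg.1 h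
    rw [holds_neg, φ.holds_iff_sat_of_holds_semantics h, Form.Sat]
  | .lt e₁ e₂, h, s => by
    obtain ⟨h₁, h₂, holds_lt⟩ := holds_semantics_lt.1 h
    rw [holds_lt, e₁.pr_eq_val_of_holds_semantics h₁, e₂.pr_eq_val_of_holds_semantics h₂, Form.Sat]

theorem Expr.pr_eq_val_of_holds_semantics :
    ∀ e : Expr AP n, (e.semantics M).Holds ν → ∀ s, ν.pr s e = e.val (ν.chain hν) s
  | .prob ψ, h, s => ψ.pr_eq_val_of_holds_semantics (by rwa [Expr.semantics] at h) s
  | .const c, h, s => by rw [holds_semantics_const.1 h, Expr.val]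
  | .add e₁ e₂, h, s => by
    obtain ⟨h₁, h₂, pr_add⟩ := holds_semantics_add.1 h
    rw [pr_add, e₁.pr_eq_val_of_holds_semantics h₁, e₂.pr_eq_val_of_holds_semantics h₂, Expr.val]
  | .sub e₁ e₂, h, s => by
    obtain ⟨h₁, h₂, pr_sub⟩ := holds_semantics_sub.1 h
    rw [pr_sub, e₁.pr_eq_val_of_holds_semantics h₁, e₂.pr_eq_val_of_holds_semantics h₂, Expr.val]
  | .mul e₁ e₂, h, s => by
    obtain ⟨h₁, h₂, pr_mul⟩ := holds_semantics_mul.1 h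
    rw [pr_mul, e₁.pr_eq_val_of_holds_semantics h₁, e₂.pr_eq_val_of_holds_semantics h₂, Expr.val]

theorem PathForm.pr_eq_val_of_holds_semantics :
    ∀ ψ : PathForm AP n, (ψ.semantics M).Holds ν →
      ∀ s, ν.pr s (.prob ψ) = (Expr.prob ψ).val (ν.chain hν) s
  | .next φ, h, s => by
    classical
    obtain ⟨h, toInt_eq, pr_eq⟩ := (holds_semantics_next hν).1 h
    rw [pr_eq, Expr.val_prob_next, DTMC.prob_next]
    refine Finset.sum_congr rfl fun s' _ => ?_
    rw [toInt_eq, if_congr (φ.holds_iff_sat_of_holds_semantics h s') rfl rfl]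
  | .unt φ₁ φ₂, h, s => by
    rw [PathForm.semantics] at h
    obtain ⟨⟨h₁, h₂⟩, -⟩ := (holds_semanticsUnboundedUntil hν).1 h
    simp only [pr_unt_eq_prob_untilPaths hν h, Expr.val_prob_unt,
      φ₁.holds_iff_sat_of_holds_semantics h₁, φ₂.holds_iff_sat_of_holds_semantics h₂]
  | .bunt φ₁ φ₂ k₁ k₂ hk, h, s => by
    rw [PathForm.semantics] at h
    obtain ⟨h₁, h₂⟩ := holds_base_of_holds_semanticsBoundedUntil h
    simp only [pr_bunt_eq_prob_boundedUntilPaths hν h, Expr.val_prob_bunt,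
      φ₁.holds_iff_sat_of_holds_semantics h₁, φ₂.holds_iff_sat_of_holds_semantics h₂]

end

end Soundness

section Occurrence

variable {S Act AP D : Type*} [Fintype S] [Fintype Act] {n : ℕ} [LinearOrder D]
  {M : MDP S Act AP} {ν : Assignment S Act AP n D} {φ₁ φ₂ : Form AP n}

mutual

theorem Form.holds_semantics_unt_of_mem_untils :
    ∀ φ : Form AP n, (φ.semantics M).Holds ν → (φ₁, φ₂) ∈ φ.untils →
      (PathForm.semantics M (.unt φ₁ φ₂)).Holds ν
  | .tru, _, hmem => hmem.elim
  | .atom _ _, _, hmem => hmem.elim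
  | .and χ₁ χ₂, h, hmem =>
    have ⟨h₁, h₂, _⟩ := holds_semantics_and.1 h
    hmem.elim (χ₁.holds_semantics_unt_of_mem_untils h₁) (χ₂.holds_semantics_unt_of_mem_untils h₂)
  | .neg χ, h, hmem =>
    χ.holds_semantics_unt_of_mem_untils (holds_semantics_neg.1 h).1 hmem
  | .lt e₁ e₂, h, hmem =>
    have ⟨h₁, h₂, _⟩ := holds_semantics_lt.1 h
    hmem.elim (e₁.holds_semantics_unt_of_mem_untils h₁) (e₂.holds_semantics_unt_of_mem_untils h₂)

theorem Expr.holds_semantics_unt_of_mem_untils :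
    ∀ e : Expr AP n, (e.semantics M).Holds ν → (φ₁, φ₂) ∈ e.untils →
      (PathForm.semantics M (.unt φ₁ φ₂)).Holds ν
  | .prob ψ, h, hmem =>
    ψ.holds_semantics_unt_of_mem_untils (by rwa [Expr.semantics] at h) hmem
  | .const _, _, hmem => hmem.elim
  | .add e₁ e₂, h, hmem =>
    have ⟨h₁, h₂, _⟩ := holds_semantics_add.1 h
    hmem.elim (e₁.holds_semantics_unt_of_mem_untils h₁) (e₂.holds_semantics_unt_of_mem_untils h₂)
  | .sub e₁ e₂, h, hmem =>
    have ⟨h₁, h₂, _⟩ := holds_semantics_sub.1 h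
    hmem.elim (e₁.holds_semantics_unt_of_mem_untils h₁) (e₂.holds_semantics_unt_of_mem_untils h₂)
  | .mul e₁ e₂, h, hmem =>
    have ⟨h₁, h₂, _⟩ := holds_semantics_mul.1 h
    hmem.elim (e₁.holds_semantics_unt_of_mem_untils h₁) (e₂.holds_semantics_unt_of_mem_untils h₂)

theorem PathForm.holds_semantics_unt_of_mem_untils :
    ∀ ψ : PathForm AP n, (ψ.semantics M).Holds ν → (φ₁, φ₂) ∈ ψ.untils →
      (PathForm.semantics M (.unt φ₁ φ₂)).Holds ν
  | .next χ, h, hmem => by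
    rw [PathForm.semantics] at h
    exact χ.holds_semantics_unt_of_mem_untils h.1.1 hmem
  | .unt χ₁ χ₂, h, hmem => by
    rw [PathForm.untils] at hmem
    obtain hmem | hmem := hmem
    · obtain ⟨rfl, rfl⟩ := Prod.mk.inj hmem
      exact h
    · rw [PathForm.semantics] at h
      exact hmem.elim (χ₁.holds_semantics_unt_of_mem_untils h.1.1)
        (χ₂.holds_semantics_unt_of_mem_untils h.1.2)
  | .bunt χ₁ χ₂ k₁ k₂ hk, h, hmem => by
    rw [PathForm.semantics] at h
    obtain ⟨h₁, h₂⟩ := holds_base_of_holds_semanticsBoundedUntil h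
    rw [PathForm.untils] at hmem
    exact hmem.elim (χ₁.holds_semantics_unt_of_mem_untils h₁)
      (χ₂.holds_semantics_unt_of_mem_untils h₂)

end

end Occurrence

section Completeness

variable {S Act AP D : Type*} [Fintype S] [Fintype Act] {n : ℕ} [LinearOrder D]

open Classical in
/-- The assignment that reads all variables semantically under the scheduler `σ`. The variable
`d_{s,φ}` is the rank of the distance from `s` to `φ` among all such distances, embedded in `D`: `D`
need not contain the distances themselves, only as many elements as there are composed states. -/
noncomputable def canonicalAssignment (M : MDP S Act AP) (σ : M.Scheduler)
    (ι : Fin (Fintype.card (Fin n → S)) ↪o D) : Assignment S Act AP n D where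
  sched := σ.1
  holds s φ := φ.Sat (M.selfComp σ n) s
  pr s e := e.val (M.selfComp σ n) s
  pr_mem s ψ := by
    rw [Expr.val]
    exact DTMC.prob_mem_Icc _ _ _
  toInt s φ := if φ.Sat (M.selfComp σ n) s then 1 else 0
  toInt_mem s φ := (ite_eq_or_eq _ 1 0).symm
  dist s φ := ι (finRank ((M.selfComp σ n).distTo (φ.Sat (M.selfComp σ n))) s)

variable {M : MDP S Act AP} {σ : M.Scheduler} {ι : Fin (Fintype.card (Fin n → S)) ↪o D}

lemma holds_semanticsUnboundedUntil_canonicalAssignment {base : SMT S Act AP n}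
    (hbase : base.Holds (canonicalAssignment M σ ι)) (φ₁ φ₂ : Form AP n) :
    (semanticsUnboundedUntil M base φ₁ φ₂).Holds (canonicalAssignment M σ ι) := by
  refine (holds_semanticsUnboundedUntil σ.2).2 ⟨hbase, fun s => ?_, fun s _ hφ₂ hpos => ?_⟩
  · simp only [canonicalAssignment, Expr.val_prob_unt]
    exact (congrFun (DTMC.untilOp_prob_untilPaths _ _ _) s).symm
  · simp only [canonicalAssignment, Expr.val_prob_unt] at hφ₂ hpos
    obtain ⟨s', hstep, hlt⟩ := (M.selfComp σ n).exists_step_distTo_lt hφ₂ hpos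
    exact ⟨s', hstep, .inr (ι.lt_iff_lt.2 (finRank_lt_finRank hlt))⟩

lemma holds_semanticsBoundedUntil_canonicalAssignment {base : SMT S Act AP n}
    (hbase : base.Holds (canonicalAssignment M σ ι)) (φ₁ φ₂ : Form AP n) (k₁ k₂ : ℕ)
    (hk : k₁ ≤ k₂) :
    (semanticsBoundedUntil M base φ₁ φ₂ k₁ k₂ hk).Holds (canonicalAssignment M σ ι) := by
  induction k₂ generalizing k₁ with
  | zero =>
    obtain rfl := Nat.le_zero.1 hk
    refine holds_semanticsBoundedUntil_zero.2 ⟨hbase, fun s => ?_⟩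
    simp only [canonicalAssignment, Expr.val_prob_bunt]
    exact DTMC.prob_boundedUntilPaths_zero_zero _ _ _ _
  | succ k₂ ih =>
    cases k₁ with
    | zero =>
      refine (holds_semanticsBoundedUntil_zero_succ σ.2).2 ⟨ih 0 _, fun s => ?_⟩
      simp only [canonicalAssignment, Expr.val_prob_bunt]
      exact DTMC.prob_boundedUntilPaths_zero_succ _ _ _ _ _
    | succ k₁ =>
      refine (holds_semanticsBoundedUntil_succ_succ σ.2).2 ⟨ih k₁ _, fun s => ?_⟩
      simp only [canonicalAssignment, Expr.val_prob_bunt]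
      exact DTMC.prob_boundedUntilPaths_succ_succ _ _ _ _ _ _

mutual

theorem Form.holds_semantics_canonicalAssignment :
    ∀ φ : Form AP n, (φ.semantics M).Holds (canonicalAssignment M σ ι)
  | .tru => holds_semantics_tru.2 fun _ => by simp only [canonicalAssignment, Form.Sat]
  | .atom a i => holds_semantics_atom.2 fun s => by
    simp only [canonicalAssignment, Form.Sat]
    rfl
  | .and φ₁ φ₂ => holds_semantics_and.2 ⟨φ₁.holds_semantics_canonicalAssignment,
    φ₂.holds_semantics_canonicalAssignment, fun s => by simp only [canonicalAssignment, Form.Sat]⟩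
  | .neg φ => holds_semantics_neg.2 ⟨φ.holds_semantics_canonicalAssignment,
    fun s => by simp only [canonicalAssignment, Form.Sat]⟩
  | .lt e₁ e₂ => holds_semantics_lt.2 ⟨e₁.holds_semantics_canonicalAssignment,
    e₂.holds_semantics_canonicalAssignment, fun s => by simp only [canonicalAssignment, Form.Sat]⟩

theorem Expr.holds_semantics_canonicalAssignment :
    ∀ e : Expr AP n, (e.semantics M).Holds (canonicalAssignment M σ ι)
  | .prob ψ => by
    rw [Expr.semantics]
    exact ψ.holds_semantics_canonicalAssignment
  | .const c => holds_semantics_const.2 fun _ => by simp only [canonicalAssignment, Expr.val]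
  | .add e₁ e₂ => holds_semantics_add.2 ⟨e₁.holds_semantics_canonicalAssignment,
    e₂.holds_semantics_canonicalAssignment, fun s => by simp only [canonicalAssignment, Expr.val]⟩
  | .sub e₁ e₂ => holds_semantics_sub.2 ⟨e₁.holds_semantics_canonicalAssignment,
    e₂.holds_semantics_canonicalAssignment, fun s => by simp only [canonicalAssignment, Expr.val]⟩
  | .mul e₁ e₂ => holds_semantics_mul.2 ⟨e₁.holds_semantics_canonicalAssignment,
    e₂.holds_semantics_canonicalAssignment, fun s => by simp only [canonicalAssignment, Expr.val]⟩

theorem PathForm.holds_semantics_canonicalAssignment :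
    ∀ ψ : PathForm AP n, (ψ.semantics M).Holds (canonicalAssignment M σ ι)
  | .next φ => (holds_semantics_next σ.2).2 ⟨φ.holds_semantics_canonicalAssignment,
    fun s => rfl, fun s => by
      simp only [canonicalAssignment, Expr.val_prob_next]
      exact DTMC.prob_next _ _ _⟩
  | .unt φ₁ φ₂ => by
    rw [PathForm.semantics]
    refine holds_semanticsUnboundedUntil_canonicalAssignment ?_ φ₁ φ₂
    exact ⟨φ₁.holds_semantics_canonicalAssignment, φ₂.holds_semantics_canonicalAssignment⟩
  | .bunt φ₁ φ₂ k₁ k₂ hk => by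
    rw [PathForm.semantics]
    refine holds_semanticsBoundedUntil_canonicalAssignment ?_ φ₁ φ₂ k₁ k₂ hk
    exact ⟨φ₁.holds_semantics_canonicalAssignment, φ₂.holds_semantics_canonicalAssignment⟩

end

end Completeness

section Correctness

variable {S Act AP D : Type*} [Fintype S] [Fintype Act] [LinearOrder D] {n : ℕ}

theorem satisfiable_semantics_and_truthEnc_iff (hD : Nonempty (Fin (Fintype.card S ^ n) ↪o D))
    (M : MDP S Act AP) (Q : Fin n → Quant) (φ : Form AP n) :
    (SMT.and (.and (schedulerChoice M) (φ.semantics M)) (truthEnc Q φ)).Satisfiable D ↔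
      ∃ σ : M.Scheduler, StatePrefix Q fun s => φ.Sat (M.selfComp σ n) s := by
  constructor
  · rintro ⟨ν, ⟨hsched, hφ⟩, htruth⟩
    have hν := (holds_schedulerChoice ν M).1 hsched
    have hQ := (holds_truthEnc ν Q φ).1 htruth
    simp only [φ.holds_iff_sat_of_holds_semantics hν hφ] at hQ
    exact ⟨⟨ν.sched, hν⟩, hQ⟩
  · rintro ⟨σ, hσ⟩
    obtain ⟨ι⟩ := hD
    have card_eq : Fintype.card (Fin n → S) = Fintype.card S ^ n := by simp
    exact ⟨canonicalAssignment M σ ((Fin.castOrderIso card_eq).toOrderEmbedding.trans ι),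
      ⟨(holds_schedulerChoice _ M).2 σ.2, φ.holds_semantics_canonicalAssignment⟩,
      (holds_truthEnc _ Q φ).2 hσ⟩

theorem satisfiable_encoding_iff_satisfies (hD : Nonempty (Fin (Fintype.card S ^ n) ↪o D))
    (M : MDP S Act AP) {Φ : Formula AP n} (hΦ : Φ.schedQ = .ex) :
    (encoding M Φ).Satisfiable D ↔ M.Satisfies Φ := by
  simp only [encoding, MDP.Satisfies, hΦ]
  exact satisfiable_semantics_and_truthEnc_iff hD M Φ.stateQ Φ.body

theorem not_satisfiable_encoding_iff_satisfies (hD : Nonempty (Fin (Fintype.card S ^ n) ↪o D))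
    (M : MDP S Act AP) {Φ : Formula AP n} (hΦ : Φ.schedQ = .all) :
    ¬ (encoding M Φ).Satisfiable D ↔ M.Satisfies Φ := by
  simp only [encoding, MDP.Satisfies, hΦ, satisfiable_semantics_and_truthEnc_iff hD, Form.Sat,
    statePrefix_dual_not, not_exists, not_not]

theorem mainAlgorithm_eq_true_iff_satisfies (hD : Nonempty (Fin (Fintype.card S ^ n) ↪o D))
    (M : MDP S Act AP) (Φ : Formula AP n) : mainAlgorithm D M Φ = true ↔ M.Satisfies Φ := by
  cases hΦ : Φ.schedQ with
  | ex => simp [mainAlgorithm, hΦ, ← satisfiable_encoding_iff_satisfies hD M hΦ]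
  | all => simp [mainAlgorithm, hΦ, ← not_satisfiable_encoding_iff_satisfies hD M hΦ]

lemma schedulerChoice_and_semantics_body_of_holds_encoding {M : MDP S Act AP} {Φ : Formula AP n}
    {ν : Assignment S Act AP n D} (h : (encoding M Φ).Holds ν) :
    (∀ s, ν.sched s ∈ M.enabled s) ∧ (Φ.body.semantics M).Holds ν := by
  rw [← holds_schedulerChoice]
  cases hΦ : Φ.schedQ <;> simp only [encoding, hΦ] at h
  · exact h.1
  · exact ⟨h.1.1, (holds_semantics_neg.1 h.1.2).1⟩

end Correctness

end HyperPCTL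

open HyperPCTL in
theorem mainTheorem1 {S Act AP D : Type*} [Fintype S] [Nonempty S] [Fintype Act] [LinearOrder D]
    {n : ℕ} (hD : Nonempty (Fin (Fintype.card S ^ n) ↪o D))
    (M : MDP S Act AP) (Φ : Formula AP n) :
    (mainAlgorithm D M Φ = true ↔ M.Satisfies Φ) ∧
    (Φ.schedQ = .ex → ((encoding M Φ).Satisfiable D ↔ M.Satisfies Φ)) ∧
    (Φ.schedQ = .all → (¬ (encoding M Φ).Satisfiable D ↔ M.Satisfies Φ)) ∧
    (∀ ν : Assignment S Act AP n D, (encoding M Φ).Holds ν →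
      ∃ σ : M.Scheduler, σ.1 = ν.sched ∧
        ∀ φ₁ φ₂ : Form AP n, (φ₁, φ₂) ∈ Φ.body.untils →
          IsLeast
            {p : (Fin n → S) → ℝ | (∀ s, p s ∈ Set.Icc (0 : ℝ) 1) ∧
              untilOp (M.selfComp σ n) (φ₁.Sat (M.selfComp σ n)) (φ₂.Sat (M.selfComp σ n)) p = p}
            (fun s => ν.pr s (.prob (.unt φ₁ φ₂))) ∧
          ∀ s, ν.pr s (.prob (.unt φ₁ φ₂)) =
            (M.selfComp σ n).prob s {π | (PathForm.unt φ₁ φ₂).Sat (M.selfComp σ n) π}) := by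
  refine ⟨mainAlgorithm_eq_true_iff_satisfies hD M Φ, satisfiable_encoding_iff_satisfies hD M,
    not_satisfiable_encoding_iff_satisfies hD M, fun ν holds_encoding => ?_⟩
  obtain ⟨hν, holds_body⟩ := schedulerChoice_and_semantics_body_of_holds_encoding holds_encoding
  refine ⟨⟨ν.sched, hν⟩, rfl, fun φ₁ φ₂ hmem => ?_⟩
  have pr_eq_val := PathForm.pr_eq_val_of_holds_semantics hν (.unt φ₁ φ₂)
    (Form.holds_semantics_unt_of_mem_untils Φ.body holds_body hmem)
  refine ⟨?_, fun s => by rw [pr_eq_val, Expr.val, Assignment.chain]⟩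
  simp only [pr_eq_val, Expr.val_prob_unt]
  exact DTMC.isLeast_prob_untilPaths _ _ _
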